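/- **Conventions.** $\beta\mathbb Z$ is the space of ultrafilters on $\mathbb Z$; integers are identified with principal ultrafilters. For $u,v\in\beta\mathbb Z$, $A\in u\otimes v\iff\{x:\{y:(x,y)\in A\}\in v\}\in u$, and $u\oplus v$ is the image of $u\otimes v$ under addition; $w^{\oplus n}=w\oplus\dots\oplus w$ ($n\ge 1$ summands), and $kw$ is the image of $w$ under $x\mapsto kx$. Let ${}^*\mathbb Z$ be a $(2^{\aleph_0})^+$-saturated elementary extension of $\mathbb Z$ in the language with a symbol for every subset of every $\mathbb Z^k$; for $A\subseteq \mathbb Z^k$ let ${}^*A$ be its interpretation in ${}^*\mathbb Z$, and write $a\models u$ if $u=\{A: a\in{}^*A\}$ (and similarly for tuples and ultrafilters on $\mathbb Z^k$). For $u,v\in\beta\mathbb Z$ and $w\in\beta\mathbb Z\setminus\{0\}$: * $w\mathrel{\tilde\mid}u$ iff there are $a\models w$, $b\models u$ with $a\mid b$ (this is used for arbitrary ultrafilters); * $u\equiv_w v$ iff there are $d\models w$ and $(a,b)\models u\otimes v$ with $d\mid a-b$; * $u\equiv^{\mathrm s}_w v$ iff there is $(d,a,b)\models w\otimes u\otimes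 v$ with $d\mid a-b$. This is a congruence of $(\beta\mathbb Z,\oplus)$, and $\beta\mathbb Z/{\equiv^{\mathrm s}_w}$ is a group under $\oplus$. Put $D(w)=\{n\in\mathbb Z:n\mathbb Z\in w\}$; $w\neq0$ is *self-divisible* if $D(w)\in w$. Put $Z_w=\{u\in\beta\mathbb Z:w\mathrel{\tilde\mid}u\}$, and let $\mathrm{MAX}$ be the set of ultrafilters $u$ with $v\mathrel{\tilde\mid}u$ for all $v\in\beta\mathbb Z\setminus\{0\}$. For a prime $p$ let $\varphi_w(p)=\max\{k\ge 0:p^k\mathbb Z\in w\}$ if this exists, and $\varphi_w(p)=\omega$ otherwise. Let $\hat{\mathbb Z}=\varprojlim\mathbb Z/n\mathbb Z$ with its profinite topology, let $\pi:\beta\mathbb Z\to\hat{\mathbb Z}$ send $u$ to the sequence of its remainder classes modulo every $n\ge 1$, and let $\sigma_w:\hat{\mathbb Z}\to\beta\mathbb Z/{\equiv^{\mathrm s}_w}$ be the well-defined group homomorphism with $\sigma_w(\pi(u))=u/{\equiv^{\mathrm s}_w}$. A profinite group is a topological group that is compact, Hausdorff and totally disconnected; it is procyclic if it has a dense cyclic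 subgroup. **Theorem.** For every $w\in\beta\mathbb Z\setminus\{0\}$ the following are equivalent. 1. $w$ is self-divisible. 2. For all $B\in w$ there is $A\in w$ such that for all $a,a'\in A$ there is $b\in B$ with $b\mid\gcd(a,a')$. 3. For all $B\in w$ there are $A\in w$ and $b\in B$ such that $A\subseteq b\mathbb Z$. 4. For all $B\in w$ there is $b\in B$ such that $b\mathbb Z\in w$. 5. For all $B\in w$ we have $\{b\in B:b\mathbb Z\in w\}\in w$. 6. For all $k\in\mathbb Z\setminus\{0\}$, $kw$ is self-divisible. 7. There are positive integers $n\neq m$ such that $w^{\oplus n}\equiv^{\mathrm s}_w w^{\oplus m}$. 8. For all $v\in\beta\mathbb Z\setminus\{0\}$, if $w\equiv_v0$ then $w\equiv^{\mathrm s}_v0$. 9. For all $a\in{}^*\mathbb Z$ with $a\models w$, $\{b\in{}^*\mathbb Z:b\mid a\}\subseteq{}^*D(w)$. 10. $Z_w$ is closed under $\oplus$ and, for all $v\in\mathrm{MAX}$ and $u,t\in\beta\mathbb Z$, if $u\oplus v\oplus t\in Z_w$ then $u\oplus t\in Z_w$. 11. $Z_w$ is closed under $\oplus$ and $Z_w=\pi^{-1}(\pi(Z_w))$.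 12. $Z_w$ is closed under $\oplus$ and whether $w\mathrel{\tilde\mid}u$ depends only on the remainder classes of $u$ modulo the integers $n\ge1$. 13. The kernel $\ker(\sigma_w)$ is closed in $\hat{\mathbb Z}$. 14. $\beta\mathbb Z/{\equiv^{\mathrm s}_w}$ is a procyclic group with respect to the quotient topology. 15. $\beta\mathbb Z/{\equiv^{\mathrm s}_w}$ is a profinite group with respect to some topology. 16. $(\beta\mathbb Z,\oplus)/{\equiv^{\mathrm s}_w}\cong\prod_pG_p$ as groups, the product being over all primes $p$, where $G_p=\mathbb Z_p$ if $\varphi_w(p)=\omega$ and $G_p=\mathbb Z/p^{\varphi_w(p)}\mathbb Z$ otherwise. -/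

import Mathlib

namespace SelfDiv

open FirstOrder FirstOrder.Language Filter

/-! ### Nonstandard extensions of the integers -/

/-- The language with one `k`-ary relation symbol for every subset of `ℤ ^ k`, for every `k`
(and no function symbols). -/
def fullLang : FirstOrder.Language.{0, 0} := ⟨fun _ => Empty, fun k => Set (Fin k → ℤ)⟩

/-- The standard structure on `ℤ`: every symbol is interpreted as itself. -/
instance : fullLang.Structure ℤ where
  funMap := fun f _ => Empty.elim f
  RelMap := fun A x => x ∈ (show Set (Fin _ → ℤ) from A)

/-- `κ`-saturation of an `L`-structure `M`: every family of subsets of `M`, definable with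
parameters from a common set `P` of size less than `κ`, which has the finite intersection property
has nonempty intersection (that is, every partial `1`-type over fewer than `κ` parameters is
realised). -/
def IsSaturated.{u, v₁, v₂} (L : FirstOrder.Language.{v₁, v₂}) (κ : Cardinal.{u}) (M : Type u)
    [L.Structure M] : Prop :=
  ∀ P : Set M, Cardinal.mk P < κ → ∀ F : Set (Set M), (∀ S ∈ F, P.Definable₁ L S) →
    (∀ G ⊆ F, G.Finite → (⋂₀ G).Nonempty) → (⋂₀ F).Nonempty

/-- `M` is a model `*ℤ` of nonstandard integers: a `(2 ^ ℵ₀)⁺`-saturated elementary extension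
of `ℤ` in the full language. -/
structure IsNonstandardModel (M : Type*) [fullLang.Structure M] : Prop where
  elementary : Nonempty (ℤ ↪ₑ[fullLang] M)
  saturated : IsSaturated fullLang (Order.succ Cardinal.continuum) M

/-- The interpretation `*A` in `M` of a set `A ⊆ ℤ ^ k`. -/
def star (M : Type*) [fullLang.Structure M] {k : ℕ} (A : Set (Fin k → ℤ)) : Set (Fin k → M) :=
  {x | Structure.RelMap (L := fullLang) (show fullLang.Relations k from A) x}

/-- `*A ⊆ *ℤ` for `A ⊆ ℤ`. -/
def star₁ (M : Type*) [fullLang.Structure M] (A : Set ℤ) : Set M :=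
  {a | ![a] ∈ star M {x : Fin 1 → ℤ | x 0 ∈ A}}

/-- `*A ⊆ *ℤ ^ 2` for `A ⊆ ℤ ^ 2`. -/
def star₂ (M : Type*) [fullLang.Structure M] (A : Set (ℤ × ℤ)) : Set (M × M) :=
  {p | ![p.1, p.2] ∈ star M {x : Fin 2 → ℤ | (x 0, x 1) ∈ A}}

/-- `*A ⊆ *ℤ ^ 3` for `A ⊆ ℤ ^ 3`. -/
def star₃ (M : Type*) [fullLang.Structure M] (A : Set (ℤ × ℤ × ℤ)) : Set (M × M × M) :=
  {p | ![p.1, p.2.1, p.2.2] ∈ star M {x : Fin 3 → ℤ | (x 0, x 1, x 2) ∈ A}}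

/-- `a ⊨ u`, i.e. `u = {A ⊆ ℤ : a ∈ *A}`. -/
def Realizes {M : Type*} [fullLang.Structure M] (a : M) (u : Ultrafilter ℤ) : Prop :=
  ∀ A : Set ℤ, A ∈ u ↔ a ∈ star₁ M A

/-- `p ⊨ u` for an ultrafilter `u` on `ℤ ^ 2`. -/
def Realizes₂ {M : Type*} [fullLang.Structure M] (p : M × M) (u : Ultrafilter (ℤ × ℤ)) : Prop :=
  ∀ A : Set (ℤ × ℤ), A ∈ u ↔ p ∈ star₂ M A

/-- `p ⊨ u` for an ultrafilter `u` on `ℤ ^ 3`. -/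
def Realizes₃ {M : Type*} [fullLang.Structure M] (p : M × M × M)
    (u : Ultrafilter (ℤ × ℤ × ℤ)) : Prop :=
  ∀ A : Set (ℤ × ℤ × ℤ), A ∈ u ↔ p ∈ star₃ M A

/-- Divisibility `a ∣ b` in `*ℤ`. -/
def StarDvd {M : Type*} [fullLang.Structure M] (a b : M) : Prop :=
  (a, b) ∈ star₂ M {p : ℤ × ℤ | p.1 ∣ p.2}

/-- The relation `d ∣ a - b` in `*ℤ`. -/
def StarDvdSub {M : Type*} [fullLang.Structure M] (d a b : M) : Prop :=
  (d, a, b) ∈ star₃ M {p : ℤ × ℤ × ℤ | p.1 ∣ p.2.1 - p.2.2}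

/-! ### Operations on `βℤ` -/

attribute [local instance] Ultrafilter.addSemigroup

/-- The product `u ⊗ v`: `A ∈ u ⊗ v` iff `{x | {y | (x, y) ∈ A} ∈ v} ∈ u`. -/
def tensor {α β : Type*} (u : Ultrafilter α) (v : Ultrafilter β) : Ultrafilter (α × β) :=
  u.bind fun x => v.map (Prod.mk x)

theorem mem_tensor {α β : Type*} (u : Ultrafilter α) (v : Ultrafilter β) (A : Set (α × β)) :
    A ∈ tensor u v ↔ {x | {y | (x, y) ∈ A} ∈ v} ∈ u := Iff.rfl

/-- The sum `u ⊕ v` of ultrafilters is Mathlib's sum: it is the image of `u ⊗ v` under `+`. -/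
theorem map_add_tensor (u v : Ultrafilter ℤ) :
    (tensor u v).map (fun p => p.1 + p.2) = u + v := by
  refine Ultrafilter.ext fun A => ?_
  rfl

/-- `w ⊕ ⋯ ⊕ w` with `n` summands (the principal ultrafilter at `0` for `n = 0`). -/
def oplusPow (w : Ultrafilter ℤ) : ℕ → Ultrafilter ℤ
  | 0 => pure 0
  | n + 1 => oplusPow w n + w

/-- `k w`, the image of `w` under multiplication by `k`. -/
def smulInt (k : ℤ) (w : Ultrafilter ℤ) : Ultrafilter ℤ := w.map (fun a => k * a)

/-! ### Divisibility and congruence of ultrafilters -/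

/-- `u ∣~ v`: there are `a ⊨ u` and `b ⊨ v` with `a ∣ b`. -/
def WDvd (M : Type*) [fullLang.Structure M] (u v : Ultrafilter ℤ) : Prop :=
  ∃ a b : M, Realizes a u ∧ Realizes b v ∧ StarDvd a b

/-- `u ≡_w v`: there are `d ⊨ w` and `(a, b) ⊨ u ⊗ v` with `d ∣ a - b`. -/
def WEquiv (M : Type*) [fullLang.Structure M] (w u v : Ultrafilter ℤ) : Prop :=
  ∃ d a b : M, Realizes d w ∧ Realizes₂ (a, b) (tensor u v) ∧ StarDvdSub d a b

/-- `u ≡ˢ_w v`: there is `(d, a, b) ⊨ w ⊗ u ⊗ v` with `d ∣ a - b`. -/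
def SEquiv (M : Type*) [fullLang.Structure M] (w u v : Ultrafilter ℤ) : Prop :=
  ∃ d a b : M, Realizes₃ (d, a, b) (tensor w (tensor u v)) ∧ StarDvdSub d a b

/-- `MAX`: the ultrafilters divisible by every nonzero ultrafilter. -/
def MAX (M : Type*) [fullLang.Structure M] : Set (Ultrafilter ℤ) :=
  {u | ∀ v : Ultrafilter ℤ, v ≠ pure 0 → WDvd M v u}

/-- `Z_w`: the ultrafilters divisible by `w`. -/
def Z (M : Type*) [fullLang.Structure M] (w : Ultrafilter ℤ) : Set (Ultrafilter ℤ) :=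
  {u | WDvd M w u}

/-- The set `nℤ`. -/
def mults (n : ℤ) : Set ℤ := {a | n ∣ a}

/-- `D(w)`: the set of integers dividing `w`. -/
def D (w : Ultrafilter ℤ) : Set ℤ := {n | mults n ∈ w}

/-- Self-divisible ultrafilters. -/
def SelfDivisible (w : Ultrafilter ℤ) : Prop := w ≠ pure 0 ∧ D w ∈ w

open Classical in
/-- `φ_u(p) = max {k : p ^ k ℤ ∈ u}` if this exists, and `φ_u(p) = ω` (encoded as `⊤`) otherwise. -/
noncomputable def phi (u : Ultrafilter ℤ) (p : Nat.Primes) : WithTop ℕ :=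
  if h : ∃ k : ℕ, IsGreatest {k : ℕ | mults (((p : ℕ) : ℤ) ^ k) ∈ u} k then
    ((h.choose : ℕ) : WithTop ℕ) else ⊤

/-- The group `ℤ_p` for `α = ω`, and `ℤ / p ^ α ℤ` for finite `α`. -/
def G (p : Nat.Primes) : WithTop ℕ → Type
  | none => @PadicInt (p : ℕ) ⟨p.2⟩
  | some k => ZMod ((p : ℕ) ^ k)

noncomputable instance (p : Nat.Primes) (α : WithTop ℕ) : AddCommGroup (G p α) :=
  match α with
  | none => inferInstanceAs (AddCommGroup (@PadicInt (p : ℕ) ⟨p.2⟩))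
  | some k => inferInstanceAs (AddCommGroup (ZMod ((p : ℕ) ^ k)))

/-! ### The profinite completion of `ℤ` -/

/-- `ℤ^`, as the group of consistent choices of remainder classes modulo each positive `n`.
It carries the subspace topology of the product of the discrete groups `ℤ / nℤ`. -/
def ZHat : AddSubgroup (∀ n : ℕ+, ZMod (n : ℕ)) where
  carrier := {x | ∀ (m n : ℕ+) (h : (m : ℕ) ∣ (n : ℕ)), ZMod.castHom h (ZMod (m : ℕ)) (x n) = x m}
  add_mem' := by
    intro x y hx hy m n h
    simp only [Pi.add_apply, map_add, hx m n h, hy m n h]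
  zero_mem' := by
    intro m n h
    simp only [Pi.zero_apply, map_zero]
  neg_mem' := by
    intro x hx m n h
    simp only [Pi.neg_apply, map_neg, hx m n h]

theorem exists_residue (u : Ultrafilter ℤ) (n : ℕ+) :
    ∃ r : ZMod (n : ℕ), {a : ℤ | (a : ZMod (n : ℕ)) = r} ∈ u := by
  obtain ⟨r, hr⟩ := (u.map (fun a : ℤ => (a : ZMod (n : ℕ)))).eq_pure_of_finite
  refine ⟨r, ?_⟩
  have : ({r} : Set (ZMod (n : ℕ))) ∈ u.map (fun a : ℤ => (a : ZMod (n : ℕ))) := by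
    rw [hr]; exact Ultrafilter.mem_pure.2 rfl
  exact this

/-- The remainder class of `u` modulo `n`. -/
noncomputable def residue (u : Ultrafilter ℤ) (n : ℕ+) : ZMod (n : ℕ) :=
  (exists_residue u n).choose

theorem residue_spec (u : Ultrafilter ℤ) (n : ℕ+) :
    ∀ᶠ a : ℤ in (u : Filter ℤ), (a : ZMod (n : ℕ)) = residue u n :=
  (exists_residue u n).choose_spec

theorem residue_eq {u : Ultrafilter ℤ} {n : ℕ+} {r : ZMod (n : ℕ)}
    (h : ∀ᶠ a : ℤ in (u : Filter ℤ), (a : ZMod (n : ℕ)) = r) : residue u n = r := by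
  obtain ⟨a, h1, h2⟩ := ((residue_spec u n).and h).exists
  rw [← h1, h2]

theorem residue_pure (k : ℤ) (n : ℕ+) : residue (pure k) n = (k : ZMod (n : ℕ)) :=
  residue_eq (u := pure k) (Filter.eventually_pure.2 rfl)

theorem residue_add (u v : Ultrafilter ℤ) (n : ℕ+) :
    residue (u + v) n = residue u n + residue v n := by
  refine residue_eq ?_
  rw [Ultrafilter.eventually_add]
  filter_upwards [residue_spec u n] with a ha
  filter_upwards [residue_spec v n] with b hb
  rw [Int.cast_add, ha, hb]

theorem residue_map_neg (u : Ultrafilter ℤ) (n : ℕ+) :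
    residue (u.map (fun a => -a)) n = -residue u n := by
  refine residue_eq ?_
  rw [Ultrafilter.coe_map, Filter.eventually_map]
  filter_upwards [residue_spec u n] with a ha
  rw [Int.cast_neg, ha]

/-- The map `π : βℤ → ℤ^`, sending an ultrafilter to its remainder classes. -/
noncomputable def toZHat (u : Ultrafilter ℤ) : ZHat :=
  ⟨fun n => residue u n, by
    intro m n h
    refine (residue_eq ?_).symm
    filter_upwards [residue_spec u n] with a ha
    rw [← ha, map_intCast]⟩

theorem toZHat_add (u v : Ultrafilter ℤ) : toZHat (u + v) = toZHat u + toZHat v :=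
  Subtype.ext (funext fun n => residue_add u v n)

theorem toZHat_surjective : Function.Surjective toZHat := by
  intro x
  let S : ℕ+ → Set ℤ := fun n => {a : ℤ | (a : ZMod (n : ℕ)) = x.1 n}
  have hmono : ∀ m n : ℕ+, (m : ℕ) ∣ (n : ℕ) → S n ⊆ S m := by
    intro m n h a ha
    have ha' : (a : ZMod (n : ℕ)) = x.1 n := ha
    change (a : ZMod (m : ℕ)) = x.1 m
    rw [← x.2 m n h, ← ha', map_intCast]
  have hne : ∀ n, (S n).Nonempty := fun n => ZMod.intCast_surjective (x.1 n)
  have hdir : Directed (· ≥ ·) (fun n => 𝓟 (S n)) := by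
    intro m n
    refine ⟨m * n, ?_, ?_⟩
    · exact Filter.principal_mono.2 (hmono _ _ (by simp))
    · exact Filter.principal_mono.2 (hmono _ _ (by simp))
  have : NeBot (⨅ n, 𝓟 (S n)) :=
    Filter.iInf_neBot_of_directed hdir fun n => Filter.principal_neBot_iff.2 (hne n)
  refine ⟨Ultrafilter.of (⨅ n, 𝓟 (S n)), Subtype.ext (funext fun n => ?_)⟩
  refine residue_eq ?_
  have h1 : S n ∈ ⨅ n, 𝓟 (S n) := Filter.mem_iInf_of_mem n (Filter.mem_principal_self _)
  exact Ultrafilter.of_le _ h1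

/-! ### The group `(βℤ, ⊕) / ≡ˢ_w` -/

section saturation

variable {M : Type*} [fullLang.Structure M]

theorem mem_star_comp (j : ℤ ↪ₑ[fullLang] M) {k : ℕ} (A : Set (Fin k → ℤ)) (x : Fin k → ℤ) :
    j ∘ x ∈ star M A ↔ x ∈ A :=
  j.map_rel (show fullLang.Relations k from A) x

/-- Transfer for the complement of a unary relation. -/
theorem star₁_compl (j : ℤ ↪ₑ[fullLang] M) (A : Set ℤ) : star₁ M Aᶜ = (star₁ M A)ᶜ := by
  let R : fullLang.Relations 1 := {x : Fin 1 → ℤ | x 0 ∈ A}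
  let R' : fullLang.Relations 1 := {x : Fin 1 → ℤ | x 0 ∈ Aᶜ}
  let φ : fullLang.Sentence :=
    ∀' ((R'.boundedFormula₁ (&0)).iff (R.boundedFormula₁ (&0)).not)
  have hZ : ℤ ⊨ φ := by
    simp only [φ, Sentence.Realize, Formula.Realize, BoundedFormula.realize_all,
      BoundedFormula.realize_iff, BoundedFormula.realize_not, BoundedFormula.realize_rel₁]
    intro a
    rfl
  have h := (j.map_sentence φ).1 hZ
  simp only [φ, Sentence.Realize, Formula.Realize, BoundedFormula.realize_all,
    BoundedFormula.realize_iff, BoundedFormula.realize_not, BoundedFormula.realize_rel₁] at h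
  ext a
  exact h a

/-- Transfer for a bijective coding `e` of triples. -/
theorem exists_decode (j : ℤ ↪ₑ[fullLang] M) (e : ℤ × ℤ × ℤ ≃ ℤ) (c : M) :
    ∃ p : M × M × M, ∀ A : Set (ℤ × ℤ × ℤ), p ∈ star₃ M A ↔ c ∈ star₁ M (e '' A) := by
  let Gr : fullLang.Relations 4 := {x : Fin 4 → ℤ | e (x 1, x 2, x 3) = x 0}
  have h1 : ∃ p : M × M × M, Structure.RelMap Gr ![c, p.1, p.2.1, p.2.2] := by
    let φ : fullLang.Sentence := ∀' ∃' ∃' ∃' (Gr.boundedFormula ![&0, &1, &2, &3])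
    have hZ : ℤ ⊨ φ := by
      simp only [φ, Sentence.Realize, Formula.Realize, BoundedFormula.realize_all,
        BoundedFormula.realize_ex, BoundedFormula.realize_rel]
      intro a
      refine ⟨(e.symm a).1, (e.symm a).2.1, (e.symm a).2.2, ?_⟩
      change e ((e.symm a).1, (e.symm a).2.1, (e.symm a).2.2) = a
      simp
    have h := (j.map_sentence φ).1 hZ
    simp only [φ, Sentence.Realize, Formula.Realize, BoundedFormula.realize_all,
      BoundedFormula.realize_ex, BoundedFormula.realize_rel] at h
    obtain ⟨x, y, z, h⟩ := h c
    refine ⟨(x, y, z), ?_⟩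
    convert h using 1
    funext i
    fin_cases i <;> rfl
  obtain ⟨⟨x, y, z⟩, hp⟩ := h1
  refine ⟨(x, y, z), fun A => ?_⟩
  let R : fullLang.Relations 3 := {x : Fin 3 → ℤ | (x 0, x 1, x 2) ∈ A}
  let R' : fullLang.Relations 1 := {x : Fin 1 → ℤ | x 0 ∈ e '' A}
  let φ : fullLang.Sentence := ∀' ∀' ∀' ∀' ((Gr.boundedFormula ![&0, &1, &2, &3]).imp
    ((R.boundedFormula ![&1, &2, &3]).iff (R'.boundedFormula ![&0])))
  have hZ : ℤ ⊨ φ := by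
    simp only [φ, Sentence.Realize, Formula.Realize, BoundedFormula.realize_all,
      BoundedFormula.realize_imp, BoundedFormula.realize_iff, BoundedFormula.realize_rel]
    intro c x y z h
    have h' : e (x, y, z) = c := h
    change (x, y, z) ∈ A ↔ c ∈ e '' A
    rw [← h', e.injective.mem_set_image]
  have h := (j.map_sentence φ).1 hZ
  simp only [φ, Sentence.Realize, Formula.Realize, BoundedFormula.realize_all,
    BoundedFormula.realize_imp, BoundedFormula.realize_iff, BoundedFormula.realize_rel] at h
  have h2 := h c x y z (by
    convert hp using 1
    funext i
    fin_cases i <;> rfl)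
  change Structure.RelMap R ![x, y, z] ↔ Structure.RelMap R' ![c]
  convert h2 using 2
  · funext i
    fin_cases i <;> rfl
  · funext i
    fin_cases i
    rfl

/-- Every ultrafilter on `ℤ` is realised in `*ℤ`. -/
theorem IsNonstandardModel.exists_realizes (hM : IsNonstandardModel M) (u : Ultrafilter ℤ) :
    ∃ a : M, Realizes a u := by
  obtain ⟨j⟩ := hM.elementary
  have hj : ∀ (A : Set ℤ) (n : ℤ), n ∈ A → j n ∈ star₁ M A := by
    intro A n hn
    have h := (mem_star_comp j {x : Fin 1 → ℤ | x 0 ∈ A} ![n]).2 hn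
    have h' : j ∘ ![n] = ![j n] := by
      funext i
      fin_cases i
      rfl
    rwa [h'] at h
  obtain ⟨c, hc⟩ := hM.saturated ∅ (by simp) {S | ∃ A ∈ u, S = star₁ M A}
    (by
      rintro S ⟨A, -, rfl⟩
      let R : fullLang.Relations 1 := {x : Fin 1 → ℤ | x 0 ∈ A}
      refine Set.empty_definable_iff.2 ⟨R.formula ![Term.var 0], ?_⟩
      ext x
      rw [Set.mem_ofPred_eq, Set.mem_ofPred_eq, Formula.realize_rel]
      change Structure.RelMap R ![x 0] ↔ _
      apply iff_of_eq
      congr 1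
      funext i
      fin_cases i
      rfl)
    (by
      intro G hG hfin
      have : ∀ S ∈ G, ∀ᶠ n in (u : Filter ℤ), j n ∈ S := by
        intro S hS
        obtain ⟨A, hA, rfl⟩ := hG hS
        filter_upwards [hA] with n hn using hj A n hn
      obtain ⟨n, hn⟩ := ((Filter.eventually_all_finite hfin).2 this).exists
      exact ⟨j n, hn⟩)
  refine ⟨c, fun A => ⟨fun hA => hc _ ⟨A, hA, rfl⟩, fun h => ?_⟩⟩
  by_contra hA
  have h' : c ∈ star₁ M Aᶜ := hc _ ⟨Aᶜ, Ultrafilter.compl_mem_iff_notMem.2 hA, rfl⟩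
  rw [star₁_compl j] at h'
  exact h' h

/-- Every ultrafilter on `ℤ ^ 3` is realised in `*ℤ`. -/
theorem IsNonstandardModel.exists_realizes₃ (hM : IsNonstandardModel M)
    (U : Ultrafilter (ℤ × ℤ × ℤ)) : ∃ p : M × M × M, Realizes₃ p U := by
  obtain ⟨e⟩ := nonempty_equiv_of_countable (α := ℤ × ℤ × ℤ) (β := ℤ)
  obtain ⟨c, hc⟩ := hM.exists_realizes (U.map e)
  obtain ⟨j⟩ := hM.elementary
  obtain ⟨p, hp⟩ := exists_decode j e c
  refine ⟨p, fun A => ?_⟩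
  rw [hp A, ← hc, Ultrafilter.mem_map, e.injective.preimage_image]

theorem IsNonstandardModel.sEquiv_iff_mem (hM : IsNonstandardModel M) (w u v : Ultrafilter ℤ) :
    SEquiv M w u v ↔
      {p : ℤ × ℤ × ℤ | p.1 ∣ p.2.1 - p.2.2} ∈ tensor w (tensor u v) := by
  constructor
  · rintro ⟨d, a, b, h, h'⟩
    exact (h _).2 h'
  · intro h
    obtain ⟨⟨d, a, b⟩, hp⟩ := hM.exists_realizes₃ (tensor w (tensor u v))
    exact ⟨d, a, b, hp, (hp _).1 h⟩

theorem IsNonstandardModel.sEquiv_iff_residue (hM : IsNonstandardModel M) {w : Ultrafilter ℤ}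
    (hw : w ≠ pure 0) (u v : Ultrafilter ℤ) :
    SEquiv M w u v ↔ ∀ᶠ d in (w : Filter ℤ), ∀ n : ℕ+, (n : ℕ) = d.natAbs →
      residue u n = residue v n := by
  have h0 : ∀ᶠ d in (w : Filter ℤ), d ≠ 0 := by
    by_contra h
    rw [← Ultrafilter.frequently_iff_eventually, Filter.not_frequently] at h
    obtain ⟨x, hx, hwx⟩ := Ultrafilter.eq_pure_of_finite_mem (Set.finite_singleton (0 : ℤ))
      (f := w) (by
        filter_upwards [h] with d hd
        simpa using hd)
    exact hw (by rw [hwx, Set.mem_singleton_iff.1 hx])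
  have key : ∀ d : ℤ, d ≠ 0 → ((∀ᶠ a in (u : Filter ℤ), ∀ᶠ b in (v : Filter ℤ), d ∣ a - b) ↔
      ∀ n : ℕ+, (n : ℕ) = d.natAbs → residue u n = residue v n) := by
    intro d hd
    have hdv : ∀ (n : ℕ+), (n : ℕ) = d.natAbs → ∀ a b : ℤ,
        (d ∣ a - b ↔ (a : ZMod (n : ℕ)) = (b : ZMod (n : ℕ))) := by
      intro n hn a b
      rw [eq_comm, ZMod.intCast_eq_intCast_iff_dvd_sub, hn, Int.natAbs_dvd]
    constructor
    · intro h n hn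
      obtain ⟨a, h1, h2⟩ := ((residue_spec u n).and h).exists
      obtain ⟨b, h3, h4⟩ := ((residue_spec v n).and h2).exists
      rw [← h1, ← h3]
      exact (hdv n hn a b).1 h4
    · intro h
      have hn := h ⟨d.natAbs, Int.natAbs_pos.2 hd⟩ rfl
      filter_upwards [residue_spec u ⟨d.natAbs, Int.natAbs_pos.2 hd⟩] with a ha
      filter_upwards [residue_spec v ⟨d.natAbs, Int.natAbs_pos.2 hd⟩] with b hb
      rw [hdv ⟨d.natAbs, Int.natAbs_pos.2 hd⟩ rfl, ha, hb, hn]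
  rw [hM.sEquiv_iff_mem]
  change (∀ᶠ d in (w : Filter ℤ), ∀ᶠ a in (u : Filter ℤ), ∀ᶠ b in (v : Filter ℤ), d ∣ a - b) ↔ _
  exact Filter.eventually_congr (h0.mono key)

/-- `≡ˢ_w` as a congruence of the semigroup `(βℤ, ⊕)`. -/
def sCon (hM : IsNonstandardModel M) (w : Ultrafilter ℤ) (hw : w ≠ pure 0) :
    AddCon (Ultrafilter ℤ) where
  r := SEquiv M w
  iseqv :=
    { refl := fun u => (hM.sEquiv_iff_residue hw u u).2 (Eventually.of_forall fun _ _ _ => rfl)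
      symm := fun {u v} h => (hM.sEquiv_iff_residue hw v u).2
        (((hM.sEquiv_iff_residue hw u v).1 h).mono fun _ h n hn => (h n hn).symm)
      trans := fun {u v t} h h' => (hM.sEquiv_iff_residue hw u t).2
        ((((hM.sEquiv_iff_residue hw u v).1 h).and
          ((hM.sEquiv_iff_residue hw v t).1 h')).mono
            fun _ h n hn => (h.1 n hn).trans (h.2 n hn)) }
  add' := fun {u v s t} h h' => (hM.sEquiv_iff_residue hw _ _).2
    ((((hM.sEquiv_iff_residue hw u v).1 h).and
      ((hM.sEquiv_iff_residue hw s t).1 h')).mono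
        fun _ h n hn => by rw [residue_add, residue_add, h.1 n hn, h.2 n hn])

/-- The quotient `βℤ / ≡ˢ_w`. -/
def BetaQuot (hM : IsNonstandardModel M) (w : Ultrafilter ℤ) (hw : w ≠ pure 0) : Type :=
  (sCon hM w hw).Quotient

variable (hM : IsNonstandardModel M) (w : Ultrafilter ℤ) (hw : w ≠ pure 0)

/-- The quotient map `ρ_w : βℤ → βℤ / ≡ˢ_w`. -/
def rho (u : Ultrafilter ℤ) : BetaQuot hM w hw := AddCon.toQuotient (c := sCon hM w hw) u

theorem rho_surjective : Function.Surjective (rho hM w hw) := fun q =>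
  AddCon.induction_on (c := sCon hM w hw) q fun u => ⟨u, rfl⟩

theorem rho_eq_iff (u v : Ultrafilter ℤ) : rho hM w hw u = rho hM w hw v ↔ SEquiv M w u v :=
  (sCon hM w hw).eq

theorem rho_eq_of_toZHat_eq {u v : Ultrafilter ℤ} (h : toZHat u = toZHat v) :
    rho hM w hw u = rho hM w hw v := by
  rw [rho_eq_iff, hM.sEquiv_iff_residue hw]
  exact Eventually.of_forall fun _ n _ => congrFun (congrArg Subtype.val h) n

/-- Addition on the quotient is the one induced by `⊕`. -/
instance : AddSemigroup (BetaQuot hM w hw) := inferInstanceAs (AddSemigroup (sCon hM w hw).Quotient)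

theorem rho_add (u v : Ultrafilter ℤ) :
    rho hM w hw (u + v) = rho hM w hw u + rho hM w hw v := rfl

/-- The map `σ_w` as a function: it sends `π(u)` to the class of `u`. -/
noncomputable def sigmaFun (x : ZHat) : BetaQuot hM w hw :=
  rho hM w hw (toZHat_surjective x).choose

theorem sigmaFun_toZHat (u : Ultrafilter ℤ) : sigmaFun hM w hw (toZHat u) = rho hM w hw u :=
  rho_eq_of_toZHat_eq hM w hw (toZHat_surjective (toZHat u)).choose_spec

theorem sigmaFun_surjective : Function.Surjective (sigmaFun hM w hw) := fun q => by
  obtain ⟨u, rfl⟩ := rho_surjective hM w hw q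
  exact ⟨toZHat u, sigmaFun_toZHat hM w hw u⟩

theorem sigmaFun_add (x y : ZHat) :
    sigmaFun hM w hw (x + y) = sigmaFun hM w hw x + sigmaFun hM w hw y := by
  obtain ⟨u, rfl⟩ := toZHat_surjective x
  obtain ⟨v, rfl⟩ := toZHat_surjective y
  rw [← toZHat_add, sigmaFun_toZHat, sigmaFun_toZHat, sigmaFun_toZHat, rho_add]

/-- `(βℤ, ⊕) / ≡ˢ_w` is a commutative group; the addition is the one induced by `⊕`. -/
noncomputable instance : AddCommGroup (BetaQuot hM w hw) :=
  { (inferInstance : AddSemigroup (BetaQuot hM w hw)) with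
    zero := sigmaFun hM w hw 0
    neg := fun q => sigmaFun hM w hw (-(sigmaFun_surjective hM w hw q).choose)
    nsmul := @nsmulRec _ ⟨sigmaFun hM w hw 0⟩ _
    zsmul := @zsmulRec _ ⟨sigmaFun hM w hw 0⟩ _
      ⟨fun q => sigmaFun hM w hw (-(sigmaFun_surjective hM w hw q).choose)⟩
      (@nsmulRec _ ⟨sigmaFun hM w hw 0⟩ _)
    zero_add := fun q => by
      obtain ⟨x, rfl⟩ := sigmaFun_surjective hM w hw q
      exact (sigmaFun_add hM w hw 0 x).symm.trans (by rw [zero_add])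
    add_zero := fun q => by
      obtain ⟨x, rfl⟩ := sigmaFun_surjective hM w hw q
      exact (sigmaFun_add hM w hw x 0).symm.trans (by rw [add_zero])
    neg_add_cancel := fun q => by
      have hq := (sigmaFun_surjective hM w hw q).choose_spec
      have h := (sigmaFun_add hM w hw (-(sigmaFun_surjective hM w hw q).choose)
        (sigmaFun_surjective hM w hw q).choose).symm
      rw [hq, neg_add_cancel] at h
      exact h
    add_comm := fun q r => by
      obtain ⟨x, rfl⟩ := sigmaFun_surjective hM w hw q
      obtain ⟨y, rfl⟩ := sigmaFun_surjective hM w hw r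
      rw [← sigmaFun_add, ← sigmaFun_add, add_comm] }

/-- The homomorphism `σ_w : ℤ^ → βℤ / ≡ˢ_w` with `σ_w(π(u)) = u / ≡ˢ_w`. -/
noncomputable def sigma : ZHat →+ BetaQuot hM w hw where
  toFun := sigmaFun hM w hw
  map_zero' := rfl
  map_add' := sigmaFun_add hM w hw

theorem sigma_toZHat (u : Ultrafilter ℤ) : sigma hM w hw (toZHat u) = rho hM w hw u :=
  sigmaFun_toZHat hM w hw u

/-- The quotient topology on `βℤ / ≡ˢ_w` induced by the topology of `βℤ`. -/
@[reducible] def quotientTopology : TopologicalSpace (BetaQuot hM w hw) :=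
  TopologicalSpace.coinduced (rho hM w hw) inferInstance

end saturation

/-- `A` is a profinite group with respect to the topology `t`: a topological group which is a
Stone space. -/
def IsProfiniteGroup {A : Type*} [AddGroup A] (t : TopologicalSpace A) : Prop :=
  IsTopologicalAddGroup A ∧ CompactSpace A ∧ T2Space A ∧ TotallyDisconnectedSpace A

/-- `A` is a procyclic group with respect to the topology `t`: a profinite group with a dense
cyclic subgroup. -/
def IsProcyclicGroup {A : Type*} [AddGroup A] (t : TopologicalSpace A) : Prop :=
  IsProfiniteGroup t ∧ ∃ g : A, Dense (AddSubgroup.zmultiples g : Set A)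

end SelfDiv

attribute [local instance] Ultrafilter.addSemigroup

open SelfDiv

/-!
# Self-divisible ultrafilters

Everything is reduced to statements about `D(w)`, the set of integers dividing `w`, and about
remainder classes. By transfer and saturation, `u ∣~ v` means that every set of `u` has an element
dividing an element of any given set of `v` (`IsNonstandardModel.wDvd_iff`), and `w ≡ˢ_v 0` means
that `D(w) ∈ v` (`IsNonstandardModel.sEquiv_zero_iff`). If `w` is self-divisible, then `≡ˢ_w` is
equality of the remainder classes modulo the elements of `D(w)`, and `w ∣~ u` says that `u` vanishes
modulo all of them; this gives every consequence of self-divisibility. In particular the quotient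
of `βℤ` embeds, as a compact group, in the product of the `ℤ / nℤ` with `n ∈ D(w)`, and by the
Chinese remainder theorem it is the product of its `p`-primary parts.

Four converses need an idea.

* If `w ^ ⊕ n ≡ˢ_w w ^ ⊕ (n + k)`, almost all integers divide `k w`; the factor `k` only matters
  at its finitely many prime divisors `p`, where almost all integers have the same exponent unless
  all powers of `p` divide `w` (`D_mem_of_D_smulInt_mem`).
* If `Z_w` is closed under sums and determined by remainder classes, then the greatest common
  divisors of `w` with `n!`, being multiples of `w` modulo `n!`, accumulate in `Z_w`. So every
  `B ∈ w` contains a divisor of one of them, hence of `w` (`IsNonstandardModel.exists_mults_mem`).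
* The point `π(w)` is always in the closure of `ker σ_w`: modulo each `n` it agrees with a point
  of the kernel (`exists_residue_eq_and_eventually_mults_mem`). So it is in the kernel if the latter
  is closed, which says that `D(w) ∈ w`.
* Every homomorphism from `ℤ^` to a profinite group has a closed kernel, since a subgroup of
  finite index `n` contains the open subgroup `n ℤ^` (`isClosed_ker_of_isProfiniteGroup`). So it
  does not matter for which topology the quotient is profinite.
-/

namespace SelfDiv

open FirstOrder FirstOrder.Language Filter

/-! ### Transfer -/

section transfer

variable {M : Type*} [fullLang.Structure M]

theorem realize_alls_iff {N : Type*} [fullLang.Structure N] {n : ℕ}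
    (φ : fullLang.BoundedFormula Empty n) :
    N ⊨ φ.alls ↔ ∀ x : Fin n → N, φ.Realize Empty.elim x := by
  rw [← BoundedFormula.realize_alls, Sentence.Realize, Formula.Realize]
  exact iff_of_eq (congrArg₂ _ (Subsingleton.elim _ _) (Subsingleton.elim _ _))

/-- A bounded formula without free variables holds at all tuples of `ℤ` iff it holds at all tuples
of an elementary extension. -/
theorem forall_realize_iff (j : ℤ ↪ₑ[fullLang] M) {n : ℕ}
    (φ : fullLang.BoundedFormula Empty n) :
    (∀ x : Fin n → ℤ, φ.Realize Empty.elim x) ↔ ∀ x : Fin n → M, φ.Realize Empty.elim x := by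
  exact (realize_alls_iff φ).symm.trans ((j.map_sentence φ.alls).trans (realize_alls_iff φ))

/-- The atomic formula `x ∘ f ∈ A` in the variables `x : Fin n → _`. -/
def atomFormula {n k : ℕ} (f : Fin k → Fin n) (A : Set (Fin k → ℤ)) :
    fullLang.BoundedFormula Empty n :=
  Relations.boundedFormula (show fullLang.Relations k from A)
    fun i => (Term.var (Sum.inr (f i)) : fullLang.Term (Empty ⊕ Fin n))

theorem realize_atomFormula {n k : ℕ} (f : Fin k → Fin n) (A : Set (Fin k → ℤ))
    (v : Empty → M) (x : Fin n → M) :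
    (atomFormula f A).Realize v x ↔ x ∘ f ∈ star M A := by
  rw [atomFormula, BoundedFormula.realize_rel]
  rfl

theorem realize_atomFormula_int {n k : ℕ} (f : Fin k → Fin n) (A : Set (Fin k → ℤ))
    (v : Empty → ℤ) (x : Fin n → ℤ) :
    (atomFormula f A).Realize v x ↔ x ∘ f ∈ A := by
  rw [atomFormula, BoundedFormula.realize_rel]
  rfl

theorem star_reindex (j : ℤ ↪ₑ[fullLang] M) {n k : ℕ} (f : Fin k → Fin n)
    (A : Set (Fin k → ℤ)) (x : Fin n → M) :
    x ∘ f ∈ star M A ↔ x ∈ star M {y : Fin n → ℤ | y ∘ f ∈ A} := by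
  have h := (forall_realize_iff j ((atomFormula f A).iff
    (atomFormula id {y : Fin n → ℤ | y ∘ f ∈ A}))).1 (fun y => by
      rw [BoundedFormula.realize_iff, realize_atomFormula_int, realize_atomFormula_int]
      rfl) x
  rwa [BoundedFormula.realize_iff, realize_atomFormula, realize_atomFormula] at h

theorem star_inter (j : ℤ ↪ₑ[fullLang] M) {n : ℕ} (A B : Set (Fin n → ℤ)) :
    star M (A ∩ B) = star M A ∩ star M B := by
  ext x
  have h := (forall_realize_iff j ((atomFormula id (A ∩ B)).iff
    (atomFormula id A ⊓ atomFormula id B))).1 (fun y => by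
      rw [BoundedFormula.realize_iff, BoundedFormula.realize_inf]
      simp only [realize_atomFormula_int]
      rfl) x
  rw [BoundedFormula.realize_iff, BoundedFormula.realize_inf] at h
  simp only [realize_atomFormula] at h
  exact h

theorem star_mono (j : ℤ ↪ₑ[fullLang] M) {n : ℕ} {A B : Set (Fin n → ℤ)} (hAB : A ⊆ B) :
    star M A ⊆ star M B := by
  intro x hx
  rw [← Set.inter_eq_left.2 hAB, star_inter j] at hx
  exact hx.2

theorem star_empty (j : ℤ ↪ₑ[fullLang] M) {n : ℕ} (x : Fin n → M) :
    x ∉ star M (∅ : Set (Fin n → ℤ)) := by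
  have h := (forall_realize_iff j (atomFormula (n := n) id ∅).not).1 (fun y => by
    rw [BoundedFormula.realize_not, realize_atomFormula_int]
    exact id) x
  rwa [BoundedFormula.realize_not, realize_atomFormula] at h

theorem mem_star₁_iff_fst (j : ℤ ↪ₑ[fullLang] M) (A : Set ℤ) (x y z : M) :
    x ∈ star₁ M A ↔ (x, y, z) ∈ star₃ M {p | p.1 ∈ A} := by
  have h := star_reindex j ![0] {x : Fin 1 → ℤ | x 0 ∈ A} ![x, y, z]
  rwa [show ![x, y, z] ∘ ![0] = ![x] by ext i; fin_cases i; rfl] at h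

theorem mem_star₁_iff_snd (j : ℤ ↪ₑ[fullLang] M) (A : Set ℤ) (x y z : M) :
    y ∈ star₁ M A ↔ (x, y, z) ∈ star₃ M {p | p.2.1 ∈ A} := by
  have h := star_reindex j ![1] {x : Fin 1 → ℤ | x 0 ∈ A} ![x, y, z]
  rwa [show ![x, y, z] ∘ ![1] = ![y] by ext i; fin_cases i; rfl] at h

theorem mem_star₂_iff_fst_snd (j : ℤ ↪ₑ[fullLang] M) (A : Set (ℤ × ℤ)) (x y z : M) :
    (x, y) ∈ star₂ M A ↔ (x, y, z) ∈ star₃ M {p | (p.1, p.2.1) ∈ A} := by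
  have h := star_reindex j ![0, 1] {x : Fin 2 → ℤ | (x 0, x 1) ∈ A} ![x, y, z]
  rwa [show ![x, y, z] ∘ ![0, 1] = ![x, y] by ext i; fin_cases i <;> rfl] at h

theorem mem_star₂_iff_snd (j : ℤ ↪ₑ[fullLang] M) (A : Set (ℤ × ℤ)) (x y z : M) :
    (y, z) ∈ star₂ M A ↔ (x, y, z) ∈ star₃ M {p | p.2 ∈ A} := by
  have h := star_reindex j ![1, 2] {x : Fin 2 → ℤ | (x 0, x 1) ∈ A} ![x, y, z]
  rwa [show ![x, y, z] ∘ ![1, 2] = ![y, z] by ext i; fin_cases i <;> rfl] at h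

theorem star₃_inter (j : ℤ ↪ₑ[fullLang] M) (A B : Set (ℤ × ℤ × ℤ)) :
    star₃ M (A ∩ B) = star₃ M A ∩ star₃ M B := by
  ext p
  exact Set.ext_iff.1 (star_inter j _ _) ![p.1, p.2.1, p.2.2]

theorem star₃_mono (j : ℤ ↪ₑ[fullLang] M) {A B : Set (ℤ × ℤ × ℤ)} (hAB : A ⊆ B) :
    star₃ M A ⊆ star₃ M B :=
  fun _ hp => star_mono j (fun _ hx => hAB hx) hp

/-- A set whose extension has a point is nonempty. -/
theorem nonempty_of_mem_star₃ (j : ℤ ↪ₑ[fullLang] M) {A : Set (ℤ × ℤ × ℤ)} {p : M × M × M}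
    (hp : p ∈ star₃ M A) : A.Nonempty := by
  rw [Set.nonempty_iff_ne_empty]
  rintro rfl
  exact star_empty j _ hp

/-- Divisibility of ultrafilters in terms of their sets only: `u ∣~ v` iff every set of `u` has an
element dividing an element of any given set of `v`. -/
theorem IsNonstandardModel.wDvd_iff (hM : IsNonstandardModel M) (u v : Ultrafilter ℤ) :
    WDvd M u v ↔ ∀ A ∈ u, ∀ B ∈ v, ∃ a ∈ A, ∃ b ∈ B, a ∣ b := by
  obtain ⟨j⟩ := hM.elementary
  constructor
  · rintro ⟨a, b, ha, hb, hab⟩ A hA B hB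
    have h : (a, b, b) ∈ star₃ M ({p : ℤ × ℤ × ℤ | p.1 ∈ A} ∩ ({p | p.2.1 ∈ B} ∩
        {p | (p.1, p.2.1) ∈ {q : ℤ × ℤ | q.1 ∣ q.2}})) := by
      rw [star₃_inter j, star₃_inter j]
      exact ⟨(mem_star₁_iff_fst j _ _ _ _).1 ((ha A).1 hA),
        (mem_star₁_iff_snd j _ _ _ _).1 ((hb B).1 hB), (mem_star₂_iff_fst_snd j _ _ _ _).1 hab⟩
    obtain ⟨⟨x, y, z⟩, h1, h2, h3⟩ := nonempty_of_mem_star₃ j h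
    exact ⟨x, h1, y, h2, h3⟩
  · intro h
    have hne : NeBot (((u : Filter ℤ) ×ˢ (v : Filter ℤ)) ⊓ 𝓟 {p : ℤ × ℤ | p.1 ∣ p.2}) := by
      rw [Filter.inf_principal_neBot_iff]
      intro S hS
      obtain ⟨A, hA, B, hB, hS⟩ := Filter.mem_prod_iff.1 hS
      obtain ⟨a, ha, b, hb, hab⟩ := h A hA B hB
      exact ⟨(a, b), hS ⟨ha, hb⟩, hab⟩
    let U : Ultrafilter (ℤ × ℤ) :=
      Ultrafilter.of (((u : Filter ℤ) ×ˢ (v : Filter ℤ)) ⊓ 𝓟 {p : ℤ × ℤ | p.1 ∣ p.2})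
    have hU : (U : Filter (ℤ × ℤ)) ≤
      ((u : Filter ℤ) ×ˢ (v : Filter ℤ)) ⊓ 𝓟 {p : ℤ × ℤ | p.1 ∣ p.2} := Ultrafilter.of_le _
    have hu : U.map Prod.fst = u := Ultrafilter.coe_le_coe.1
      (Filter.tendsto_fst.mono_left (hU.trans inf_le_left))
    have hv : U.map Prod.snd = v := Ultrafilter.coe_le_coe.1
      (Filter.tendsto_snd.mono_left (hU.trans inf_le_left))
    have hd : {p : ℤ × ℤ | p.1 ∣ p.2} ∈ U := hU (Filter.mem_inf_of_right (mem_principal_self _))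
    obtain ⟨⟨a, b, c⟩, hp⟩ := hM.exists_realizes₃ (U.map fun p => (p.1, p.2, 0))
    refine ⟨a, b, fun A => ?_, fun B => ?_, ?_⟩
    · rw [mem_star₁_iff_fst j A a b c, ← hp, ← hu]
      rfl
    · rw [mem_star₁_iff_snd j B a b c, ← hp, ← hv]
      rfl
    · exact (mem_star₂_iff_fst_snd j _ a b c).2 ((hp _).1 hd)

/-- `*D(w)` is closed under divisors, because `D(w)` is. -/
theorem mem_star₁_D_of_starDvd (j : ℤ ↪ₑ[fullLang] M) {w : Ultrafilter ℤ} {a b : M}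
    (ha : a ∈ star₁ M (D w)) (h : StarDvd b a) : b ∈ star₁ M (D w) := by
  rw [mem_star₁_iff_fst j _ b a a]
  have h' : (b, a, a) ∈ star₃ M ({p | p.2.1 ∈ D w} ∩
      {p | (p.1, p.2.1) ∈ {q : ℤ × ℤ | q.1 ∣ q.2}}) := by
    rw [star₃_inter j]
    exact ⟨(mem_star₁_iff_snd j _ _ _ _).1 ha, (mem_star₂_iff_fst_snd j _ _ _ _).1 h⟩
  refine star₃_mono j ?_ h'
  rintro ⟨x, y, z⟩ ⟨h1, h2⟩
  exact mem_of_superset (h1 : mults y ∈ (w : Filter ℤ)) fun t ht => Dvd.dvd.trans h2 ht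

theorem starDvd_refl (j : ℤ ↪ₑ[fullLang] M) (a : M) : StarDvd a a := by
  have h := (forall_realize_iff j (atomFormula (n := 1) ![0, 0]
    {x : Fin 2 → ℤ | (x 0, x 1) ∈ {p : ℤ × ℤ | p.1 ∣ p.2}})).1 (fun y => by
      rw [realize_atomFormula_int]
      exact dvd_refl (y 0)) ![a]
  rw [realize_atomFormula, show ![a] ∘ ![0, 0] = ![a, a] by ext i; fin_cases i <;> rfl] at h
  exact h

/-- If a self-divisible `w` satisfies `w ≡_v 0`, then `v`-almost all integers divide `w`. -/
theorem IsNonstandardModel.D_mem_of_wEquiv (hM : IsNonstandardModel M) {w v : Ultrafilter ℤ}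
    (hw : D w ∈ w) (h : WEquiv M v w (pure 0)) : D w ∈ v := by
  obtain ⟨j⟩ := hM.elementary
  obtain ⟨d, a, b, hd, hab, hdvd⟩ := h
  by_contra hv
  have h1 : {p : ℤ × ℤ | p.1 ∈ D w ∧ p.2 = 0} ∈ tensor w (pure (0 : ℤ)) := by
    rw [mem_tensor]
    filter_upwards [hw] with x hx
    exact Ultrafilter.mem_pure.2 ⟨hx, rfl⟩
  have h2 : (d, a, b) ∈ star₃ M ({p | p.1 ∈ (D w)ᶜ} ∩ ({p | p.2 ∈ {p : ℤ × ℤ | p.1 ∈ D w ∧ p.2 = 0}}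
      ∩ {p : ℤ × ℤ × ℤ | p.1 ∣ p.2.1 - p.2.2})) := by
    rw [star₃_inter j, star₃_inter j]
    exact ⟨(mem_star₁_iff_fst j _ _ _ _).1 ((hd _).1 (Ultrafilter.compl_mem_iff_notMem.2 hv)),
      (mem_star₂_iff_snd j _ _ _ _).1 ((hab _).1 h1), hdvd⟩
  obtain ⟨⟨x, y, z⟩, h3, ⟨h4, h5⟩, h6⟩ := nonempty_of_mem_star₃ j h2
  simp only at h4 h5
  refine h3 (mem_of_superset (h4 : mults y ∈ (w : Filter ℤ)) fun t ht => Dvd.dvd.trans ?_ ht)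
  simpa [h5] using (h6 : x ∣ y - z)

theorem IsNonstandardModel.wEquiv_self_zero (hM : IsNonstandardModel M) (w : Ultrafilter ℤ) :
    WEquiv M w w (pure 0) := by
  obtain ⟨j⟩ := hM.elementary
  obtain ⟨⟨d, a, b⟩, hp⟩ := hM.exists_realizes₃ (w.map fun x => (x, x, 0))
  refine ⟨d, a, b, fun A => ?_, fun A => ?_, (hp _).1 ?_⟩
  · rw [mem_star₁_iff_fst j A d a b, ← hp]
    rfl
  · rw [mem_star₂_iff_snd j A d a b, ← hp]
    rfl
  · have h : ∀ᶠ x in (w : Filter ℤ), x ∣ x - 0 :=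
      Eventually.of_forall fun x => dvd_sub_self_left.2 (dvd_zero x)
    exact h

theorem IsNonstandardModel.sEquiv_zero_iff (hM : IsNonstandardModel M) (w v : Ultrafilter ℤ) :
    SEquiv M v w (pure 0) ↔ D w ∈ v := by
  rw [hM.sEquiv_iff_mem, mem_tensor]
  have : {x | {y : ℤ × ℤ | (x, y) ∈ {p : ℤ × ℤ × ℤ | p.1 ∣ p.2.1 - p.2.2}} ∈
      tensor w (pure (0 : ℤ))} = D w := by
    ext d
    change {a | d ∣ a - 0} ∈ w ↔ {a | d ∣ a} ∈ w
    simp only [sub_zero]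
  rw [this]

end transfer

/-! ### Divisors and remainder classes of an ultrafilter -/

theorem mults_natAbs (d : ℤ) : mults (d.natAbs : ℤ) = mults d :=
  Set.ext fun _ => Int.natAbs_dvd

theorem exists_pnat_eq_natAbs {d : ℤ} (hd : d ≠ 0) : ∃ m : ℕ+, (m : ℕ) = d.natAbs :=
  ⟨⟨d.natAbs, Int.natAbs_pos.2 hd⟩, rfl⟩

theorem mults_mem_of_dvd {u : Ultrafilter ℤ} {m n : ℤ} (h : m ∣ n) (hn : mults n ∈ u) :
    mults m ∈ u :=
  mem_of_superset (hn : mults n ∈ (u : Filter ℤ)) fun _ ha => Dvd.dvd.trans h ha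

theorem eventually_ne_zero {w : Ultrafilter ℤ} (hw : w ≠ pure 0) :
    ∀ᶠ d in (w : Filter ℤ), d ≠ 0 := by
  refine Ultrafilter.compl_mem_iff_notMem.2 fun h => hw ?_
  obtain ⟨x, hx, hwx⟩ := Ultrafilter.eq_pure_of_finite_mem (Set.finite_singleton (0 : ℤ)) h
  rw [hwx, Set.mem_singleton_iff.1 hx]

theorem mults_mem_iff_residue (u : Ultrafilter ℤ) (n : ℕ+) :
    mults ((n : ℕ) : ℤ) ∈ u ↔ residue u n = 0 := by
  constructor
  · intro h
    refine residue_eq ?_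
    filter_upwards [(h : mults _ ∈ (u : Filter ℤ))] with a ha
    exact (ZMod.intCast_zmod_eq_zero_iff_dvd a n).2 ha
  · intro h
    change ∀ᶠ a in (u : Filter ℤ), ((n : ℕ) : ℤ) ∣ a
    filter_upwards [residue_spec u n] with a ha
    rw [h] at ha
    exact (ZMod.intCast_zmod_eq_zero_iff_dvd a n).1 ha

theorem residue_eq_residue_iff (u v : Ultrafilter ℤ) (n : ℕ+) :
    residue u n = residue v n ↔ mults ((n : ℕ) : ℤ) ∈ u + v.map (fun a => -a) := by
  rw [mults_mem_iff_residue, residue_add, residue_map_neg, ← sub_eq_add_neg, sub_eq_zero]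

theorem castHom_residue (u : Ultrafilter ℤ) {m n : ℕ+} (h : (m : ℕ) ∣ (n : ℕ)) :
    ZMod.castHom h (ZMod (m : ℕ)) (residue u n) = residue u m :=
  (toZHat u).2 m n h

theorem residue_oplusPow (w : Ultrafilter ℤ) (k : ℕ) (n : ℕ+) :
    residue (oplusPow w k) n = (k : ZMod (n : ℕ)) * residue w n := by
  induction k with
  | zero => rw [oplusPow, residue_pure, Int.cast_zero, Nat.cast_zero, zero_mul]
  | succ k ih => rw [oplusPow, residue_add, ih, Nat.cast_succ, add_mul, one_mul]

/-- An integer representative of the remainder class of `u` modulo `n`. -/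
theorem exists_representative (u : Ultrafilter ℤ) {n : ℕ} (hn : n ≠ 0) :
    ∃ r : ℤ, ∀ᶠ a in (u : Filter ℤ), (n : ℤ) ∣ a - r := by
  obtain ⟨r, hr⟩ := ZMod.intCast_surjective (residue u ⟨n, Nat.pos_of_ne_zero hn⟩)
  refine ⟨r, ?_⟩
  filter_upwards [residue_spec u ⟨n, Nat.pos_of_ne_zero hn⟩] with a ha
  rw [← hr] at ha
  exact (ZMod.intCast_eq_intCast_iff_dvd_sub r a n).1 ha.symm

theorem mults_mem_iff_dvd {u : Ultrafilter ℤ} {n m r : ℤ} (hr : ∀ᶠ a in (u : Filter ℤ), n ∣ a - r)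
    (hm : m ∣ n) : mults m ∈ u ↔ m ∣ r := by
  have h : ∀ᶠ a in (u : Filter ℤ), (m ∣ a ↔ m ∣ r) := by
    filter_upwards [hr] with a ha
    exact dvd_iff_dvd_of_dvd_sub (hm.trans ha)
  exact (eventually_congr h).trans eventually_const

/-- Divisibility of an ultrafilter by a nonzero integer is tested on prime powers. -/
theorem mults_mem_iff_prime_pow (u : Ultrafilter ℤ) {n : ℕ} (hn : n ≠ 0) :
    mults (n : ℤ) ∈ u ↔ ∀ p k : ℕ, p.Prime → p ^ k ∣ n → mults ((p : ℤ) ^ k) ∈ u := by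
  obtain ⟨r, hr⟩ := exists_representative u hn
  rw [mults_mem_iff_dvd hr dvd_rfl, Int.natCast_dvd, Nat.dvd_iff_prime_pow_dvd_dvd]
  refine forall_congr' fun p => forall_congr' fun k => forall_congr' fun _ =>
    forall_congr' fun h => ?_
  rw [mults_mem_iff_dvd hr (by exact_mod_cast h), ← Nat.cast_pow, Int.natCast_dvd]

/-- For a self-divisible `w`, the congruence `≡ˢ_w` is equality of the remainder classes modulo
the integers dividing `w`. -/
theorem IsNonstandardModel.sEquiv_iff_of_selfDivisible {M : Type*} [fullLang.Structure M]
    (hM : IsNonstandardModel M) {w : Ultrafilter ℤ} (hw : SelfDivisible w) (u v : Ultrafilter ℤ) :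
    SEquiv M w u v ↔ ∀ n : ℕ+, mults ((n : ℕ) : ℤ) ∈ w → residue u n = residue v n := by
  rw [hM.sEquiv_iff_residue hw.1]
  constructor
  · intro h n hn
    obtain ⟨d, ⟨h1, h2⟩, h3⟩ :=
      ((h.and (hn : mults _ ∈ (w : Filter ℤ))).and (eventually_ne_zero hw.1)).exists
    obtain ⟨m, hm⟩ := exists_pnat_eq_natAbs h3
    have hd : (n : ℕ) ∣ (m : ℕ) := hm ▸ Int.natCast_dvd.1 h2
    rw [← castHom_residue u hd, ← castHom_residue v hd, h1 m hm]
  · intro h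
    filter_upwards [(hw.2 : D w ∈ (w : Filter ℤ))] with d hd n hn
    refine h n ?_
    rw [hn, mults_natAbs]
    exact hd

/-! ### Elementary characterizations of self-divisibility -/

theorem D_mem_of_forall_exists_mults {w : Ultrafilter ℤ} (h : ∀ B ∈ w, ∃ b ∈ B, mults b ∈ w) :
    D w ∈ w := by
  by_contra hD
  obtain ⟨b, hb, hb'⟩ := h _ (Ultrafilter.compl_mem_iff_notMem.2 hD)
  exact hb hb'

/-- A set of `w` any two elements of which have a common divisor in `B` is covered by the multiples
of the finitely many divisors in `B` of any of its nonzero elements. -/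
theorem exists_mults_of_gcd {w : Ultrafilter ℤ} (hw : w ≠ pure 0) {A B : Set ℤ} (hA : A ∈ w)
    (h : ∀ a ∈ A, ∀ a' ∈ A, ∃ b ∈ B, b ∣ (Int.gcd a a' : ℤ)) : ∃ b ∈ B, mults b ∈ w := by
  obtain ⟨a, ha, ha0⟩ := (Eventually.and (hA : A ∈ (w : Filter ℤ)) (eventually_ne_zero hw)).exists
  have hfin : {b : ℤ | b ∈ B ∧ b ∣ a}.Finite := by
    refine (Set.finite_Icc (-|a|) |a|).subset fun b hb => abs_le.1 ?_
    exact Int.le_of_dvd (abs_pos.2 ha0) ((abs_dvd_abs b a).2 hb.2)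
  have hcov : (⋃ b ∈ {b : ℤ | b ∈ B ∧ b ∣ a}, mults b) ∈ w := by
    refine mem_of_superset (hA : A ∈ (w : Filter ℤ)) fun a' ha' => ?_
    obtain ⟨b, hb, hba⟩ := h a ha a' ha'
    exact Set.mem_biUnion (x := b) ⟨hb, hba.trans (Int.gcd_dvd_left _ _)⟩
      (hba.trans (Int.gcd_dvd_right _ _))
  obtain ⟨b, hb, hbw⟩ := (Ultrafilter.finite_biUnion_mem_iff hfin).1 hcov
  exact ⟨b, hb.1, hbw⟩

theorem selfDivisible_smulInt {w : Ultrafilter ℤ} (hw : SelfDivisible w) {k : ℤ} (hk : k ≠ 0) :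
    SelfDivisible (smulInt k w) := by
  refine ⟨fun h => ?_, ?_⟩
  · have h0 : {a : ℤ | a = 0} ∈ smulInt k w := by
      rw [h]
      exact Ultrafilter.mem_pure.2 rfl
    have h1 : ∀ᶠ a in (w : Filter ℤ), k * a = 0 := h0
    obtain ⟨a, ha, ha0⟩ := (h1.and (eventually_ne_zero hw.1)).exists
    exact mul_ne_zero hk ha0 ha
  · change ∀ᶠ d in (w : Filter ℤ), ∀ᶠ a in (w : Filter ℤ), k * d ∣ k * a
    filter_upwards [(hw.2 : D w ∈ (w : Filter ℤ))] with d hd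
    filter_upwards [(hd : mults d ∈ (w : Filter ℤ))] with a ha
    exact mul_dvd_mul_left k ha

theorem smulInt_one (w : Ultrafilter ℤ) : smulInt 1 w = w := by
  rw [smulInt]
  simp only [one_mul]
  exact Ultrafilter.map_id w

/-- If `w`-almost all integers divide `k w`, then `w` is self-divisible: away from `k`, passing
from `w` to `k w` changes no divisibility by prime powers, and for each of the finitely many
primes `p ∣ k` either every power of `p` divides `w`, or the exponent of `p` is constant on a set
of `w`. -/
theorem D_mem_of_D_smulInt_mem {w : Ultrafilter ℤ} (hw : w ≠ pure 0) {k : ℕ} (hk : k ≠ 0)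
    (h : ∀ᶠ d : ℤ in (w : Filter ℤ), ∀ᶠ a : ℤ in (w : Filter ℤ), d ∣ (k : ℤ) * a) : D w ∈ w := by
  have hp : ∀ p ∈ k.primeFactors, ∀ᶠ d in (w : Filter ℤ), ∀ i : ℕ,
      (p : ℤ) ^ i ∣ d → mults ((p : ℤ) ^ i) ∈ w := by
    intro p _
    by_cases hex : ∃ i : ℕ, mults ((p : ℤ) ^ i) ∉ w
    · classical
      filter_upwards [Ultrafilter.compl_mem_iff_notMem.2 (Nat.find_spec hex)] with d hd i hi
      by_contra hiw
      exact hd ((pow_dvd_pow (p : ℤ) (Nat.find_min' hex hiw)).trans hi)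
    · push Not at hex
      exact Eventually.of_forall fun d i _ => hex i
  filter_upwards [h, eventually_ne_zero hw, (Filter.eventually_all_finset _).2 hp] with d h1 h2 h3
  change mults d ∈ w
  rw [← mults_natAbs, mults_mem_iff_prime_pow w (Int.natAbs_ne_zero.2 h2)]
  intro p i hpp hi
  have hi' : (p : ℤ) ^ i ∣ d := by
    rw [← Int.dvd_natAbs]
    exact_mod_cast hi
  by_cases hpk : p ∣ k
  · exact h3 p (Nat.mem_primeFactors.2 ⟨hpp, hpk, hk⟩) i hi'
  · change ∀ᶠ a in (w : Filter ℤ), (p : ℤ) ^ i ∣ a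
    filter_upwards [h1] with a ha
    have hcop : IsCoprime ((p : ℤ) ^ i) (k : ℤ) :=
      (Nat.isCoprime_iff_coprime.2 ((Nat.Prime.coprime_iff_not_dvd hpp).2 hpk)).pow_left
    exact hcop.dvd_of_dvd_mul_left (hi'.trans ha)

section model

variable {M : Type*} [fullLang.Structure M]

theorem IsNonstandardModel.D_mem_of_sEquiv_oplusPow (hM : IsNonstandardModel M)
    {w : Ultrafilter ℤ} (hw : w ≠ pure 0) {n k : ℕ} (hk : k ≠ 0)
    (h : SEquiv M w (oplusPow w n) (oplusPow w (n + k))) : D w ∈ w := by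
  refine D_mem_of_D_smulInt_mem hw hk ?_
  rw [hM.sEquiv_iff_residue hw] at h
  filter_upwards [h, eventually_ne_zero hw] with d hd hd0
  obtain ⟨m, hm⟩ := exists_pnat_eq_natAbs hd0
  have hd' := hd m hm
  rw [residue_oplusPow, residue_oplusPow, Nat.cast_add, add_mul, left_eq_add] at hd'
  filter_upwards [residue_spec w m] with a ha
  rw [← ha] at hd'
  rw [← Int.natAbs_dvd, ← hm]
  refine (ZMod.intCast_zmod_eq_zero_iff_dvd _ _).1 ?_
  push_cast
  exact hd'

theorem SelfDivisible.sEquiv_oplusPow (hM : IsNonstandardModel M) {w : Ultrafilter ℤ}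
    (hw : SelfDivisible w) : SEquiv M w (oplusPow w 1) (oplusPow w 2) := by
  rw [hM.sEquiv_iff_of_selfDivisible hw]
  intro n hn
  rw [residue_oplusPow, residue_oplusPow, (mults_mem_iff_residue w n).1 hn, mul_zero, mul_zero]

/-! ### The ultrafilters divisible by `w` -/

theorem IsNonstandardModel.mults_mem_of_wDvd (hM : IsNonstandardModel M) {w u : Ultrafilter ℤ}
    (h : WDvd M w u) {n : ℤ} (hn : mults n ∈ w) : mults n ∈ u := by
  by_contra hu
  obtain ⟨a, ha, b, hb, hab⟩ :=
    (hM.wDvd_iff w u).1 h _ hn _ (Ultrafilter.compl_mem_iff_notMem.2 hu)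
  exact hb (Dvd.dvd.trans ha hab)

theorem IsNonstandardModel.wDvd_of_D_mem (hM : IsNonstandardModel M) {w u : Ultrafilter ℤ}
    (h : D u ∈ w) : WDvd M w u := by
  refine (hM.wDvd_iff w u).2 fun A hA B hB => ?_
  obtain ⟨a, ha, ha'⟩ := (Eventually.and (hA : A ∈ (w : Filter ℤ)) h).exists
  obtain ⟨b, hb, hb'⟩ := (Eventually.and (hB : B ∈ (u : Filter ℤ)) ha').exists
  exact ⟨a, ha, b, hb, hb'⟩

theorem IsNonstandardModel.wDvd_iff_of_selfDivisible (hM : IsNonstandardModel M)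
    {w : Ultrafilter ℤ} (hw : SelfDivisible w) (u : Ultrafilter ℤ) :
    WDvd M w u ↔ ∀ n : ℕ+, mults ((n : ℕ) : ℤ) ∈ w → residue u n = 0 := by
  constructor
  · intro h n hn
    exact (mults_mem_iff_residue u n).1 (hM.mults_mem_of_wDvd h hn)
  · intro h
    refine hM.wDvd_of_D_mem ?_
    filter_upwards [(hw.2 : D w ∈ (w : Filter ℤ)), eventually_ne_zero hw.1] with d hd hd0
    obtain ⟨m, hm⟩ := exists_pnat_eq_natAbs hd0
    have hd' := h m (by rw [hm, mults_natAbs]; exact hd)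
    rwa [← mults_mem_iff_residue, hm, mults_natAbs] at hd'

theorem IsNonstandardModel.mem_MAX_iff (hM : IsNonstandardModel M) (u : Ultrafilter ℤ) :
    u ∈ MAX M ↔ ∀ n : ℕ+, residue u n = 0 := by
  constructor
  · intro h n
    have hn : (pure ((n : ℕ) : ℤ) : Ultrafilter ℤ) ≠ pure 0 := by
      intro h
      have := Ultrafilter.pure_injective h
      exact n.ne_zero (by exact_mod_cast this)
    rw [← mults_mem_iff_residue]
    exact hM.mults_mem_of_wDvd (h _ hn) (Ultrafilter.mem_pure.2 (dvd_refl _))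
  · intro h v hv
    refine hM.wDvd_of_D_mem ?_
    filter_upwards [eventually_ne_zero hv] with d hd0
    obtain ⟨m, hm⟩ := exists_pnat_eq_natAbs hd0
    have hd' := h m
    rwa [← mults_mem_iff_residue, hm, mults_natAbs] at hd'

theorem SelfDivisible.add_mem_Z (hM : IsNonstandardModel M) {w : Ultrafilter ℤ}
    (hw : SelfDivisible w) {u v : Ultrafilter ℤ} (hu : u ∈ Z M w) (hv : v ∈ Z M w) :
    u + v ∈ Z M w := by
  refine (hM.wDvd_iff_of_selfDivisible hw _).2 fun n hn => ?_
  rw [residue_add, (hM.wDvd_iff_of_selfDivisible hw u).1 hu n hn,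
    (hM.wDvd_iff_of_selfDivisible hw v).1 hv n hn, add_zero]

/-- If `Z_w` is closed under sums and under cancelling elements of `MAX`, it only depends on
remainder classes: from `u ∈ Z_w` and `π(u) = π(u')` one gets `(u' ⊖ u') ⊕ u ∈ Z_w`, and
`⊖ u' ⊕ u ∈ MAX` may be cancelled. -/
theorem IsNonstandardModel.mem_Z_of_residue_eq (hM : IsNonstandardModel M) {w : Ultrafilter ℤ}
    (hw : w ≠ pure 0) (hadd : ∀ u ∈ Z M w, ∀ v ∈ Z M w, u + v ∈ Z M w)
    (hmax : ∀ v ∈ MAX M, ∀ u t : Ultrafilter ℤ, u + v + t ∈ Z M w → u + t ∈ Z M w)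
    {u u' : Ultrafilter ℤ} (h : ∀ n : ℕ+, residue u n = residue u' n) (hu : u ∈ Z M w) :
    u' ∈ Z M w := by
  have hzero : ∀ u : Ultrafilter ℤ, u + pure 0 = u := fun u => Ultrafilter.ext fun A => by
    change {a | a + 0 ∈ A} ∈ u ↔ A ∈ u
    simp only [add_zero, Set.ofPred_mem_eq]
  rw [← hzero u']
  have h1 : u' + u'.map (fun a => -a) ∈ Z M w :=
    (hM.mem_MAX_iff _).2 (fun n => by rw [residue_add, residue_map_neg, add_neg_cancel]) w hw
  refine hmax (u'.map (fun a => -a) + u) ((hM.mem_MAX_iff _).2 fun n => ?_) u' (pure 0) ?_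
  · rw [residue_add, residue_map_neg, h n, neg_add_cancel]
  · rw [hzero, ← add_assoc]
    exact hadd _ h1 _ hu

end model

section model

variable {M : Type*} [fullLang.Structure M]

/-- If `Z_w` is closed under sums and only depends on remainder classes, every `B ∈ w` has an
element dividing `w`. The greatest common divisor `m n` of `n!` and `w` divides `w` and is a
multiple of `w` modulo `n!`. A limit of the `m n` has the same remainder classes as a limit of
multiples of `w`; the latter is in `Z_w`, hence so is the former, and some `m n` is a multiple of
an element of `B`. -/
theorem IsNonstandardModel.exists_mults_mem (hM : IsNonstandardModel M) {w : Ultrafilter ℤ}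
    (hadd : ∀ u ∈ Z M w, ∀ v ∈ Z M w, u + v ∈ Z M w)
    (hres : ∀ u u' : Ultrafilter ℤ, (∀ n : ℕ+, residue u n = residue u' n) →
      (WDvd M w u ↔ WDvd M w u')) {B : Set ℤ} (hB : B ∈ w) : ∃ b ∈ B, mults b ∈ w := by
  have hself : w ∈ Z M w := by
    refine (hM.wDvd_iff w w).2 fun A hA C hC => ?_
    obtain ⟨a, ha, ha'⟩ := (Eventually.and (hA : A ∈ (w : Filter ℤ)) hC).exists
    exact ⟨a, ha, a, ha', dvd_rfl⟩
  have hpow : ∀ k, oplusPow w (k + 1) ∈ Z M w := by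
    intro k
    induction k with
    | zero =>
      refine (hres _ _ fun n => ?_).1 hself
      rw [residue_oplusPow, zero_add, Nat.cast_one, one_mul]
    | succ k ih => exact hadd _ ih _ hself
  have hgcd : ∀ n : ℕ, ∃ (m : ℤ) (k : ℕ), mults m ∈ w ∧ ∀ N : ℕ+, (N : ℕ) ∣ n.factorial →
      residue (oplusPow w (k + 1)) N = m := by
    intro n
    obtain ⟨r, hr⟩ := exists_representative w n.factorial_ne_zero
    -- A Bézout coefficient of `r`, made positive by adding a multiple of `n!`.
    set c : ℤ := Int.gcdA r n.factorial with hc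
    have hfac : (1 : ℤ) ≤ n.factorial := by exact_mod_cast n.factorial_pos
    obtain ⟨k, hk⟩ : ∃ k : ℕ, (k : ℤ) + 1 = c + n.factorial * (|c| + 1) := by
      refine ⟨(c + n.factorial * (|c| + 1) - 1).toNat, ?_⟩
      rw [Int.toNat_of_nonneg]
      · ring
      · nlinarith [neg_abs_le c, abs_nonneg c]
    refine ⟨Int.gcd r n.factorial, k, ?_, fun N hN => ?_⟩
    · exact (mults_mem_iff_dvd hr (Int.gcd_dvd_right _ _)).2 (Int.gcd_dvd_left _ _)
    · have hrN : residue w N = r := by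
        refine residue_eq ?_
        filter_upwards [hr] with a ha
        exact ((ZMod.intCast_eq_intCast_iff_dvd_sub r a N).2
          ((Int.natCast_dvd_natCast.2 hN).trans ha)).symm
      have hk' : ((k + 1 : ℕ) : ZMod (N : ℕ)) =
          ((c + n.factorial * (|c| + 1) : ℤ) : ZMod (N : ℕ)) := by
        rw [← hk]
        push_cast
        rfl
      have h0 : ((n.factorial : ℕ) : ZMod (N : ℕ)) = 0 := (ZMod.natCast_eq_zero_iff _ _).2 hN
      rw [residue_oplusPow, hrN, hk', Int.gcd_eq_gcd_ab]
      push_cast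
      rw [h0, hc]
      ring
  choose m k hm hmk using hgcd
  have hfac : ∀ N : ℕ+, ∀ᶠ n in (hyperfilter ℕ : Filter ℕ), (N : ℕ) ∣ n.factorial := by
    intro N
    filter_upwards [Nat.hyperfilter_le_atTop (eventually_ge_atTop (N : ℕ))] with n hn
    exact Nat.dvd_factorial N.pos hn
  have hlim : WDvd M w ((hyperfilter ℕ).bind fun n => oplusPow w (k n + 1)) := by
    refine (hM.wDvd_iff _ _).2 fun A hA C hC => ?_
    have hC' : ∀ᶠ n in (hyperfilter ℕ : Filter ℕ), C ∈ oplusPow w (k n + 1) := hC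
    obtain ⟨n, hn⟩ := hC'.exists
    exact (hM.wDvd_iff _ _).1 (hpow (k n)) A hA C hn
  have hlim' : WDvd M w ((hyperfilter ℕ).map m) := by
    refine (hres _ _ fun N => residue_eq ?_).1 hlim
    have h1 : ∀ᶠ n in (hyperfilter ℕ : Filter ℕ),
        ((m n : ℤ) : ZMod (N : ℕ)) = residue ((hyperfilter ℕ).map m) N :=
      residue_spec ((hyperfilter ℕ).map m) N
    have h2 : ∀ᶠ n in (hyperfilter ℕ : Filter ℕ), ∀ᶠ a : ℤ in (oplusPow w (k n + 1) : Filter ℤ),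
        (a : ZMod (N : ℕ)) = residue ((hyperfilter ℕ).map m) N := by
      filter_upwards [h1, hfac N] with n hn1 hn2
      rw [← hn1, ← hmk n N hn2]
      exact residue_spec _ N
    exact h2
  obtain ⟨b, hb, c, ⟨n, rfl⟩, hbc⟩ := (hM.wDvd_iff _ _).1 hlim' B hB (Set.range m)
    (Eventually.of_forall fun n => ⟨n, rfl⟩ : ∀ᶠ n in (hyperfilter ℕ : Filter ℕ), m n ∈ Set.range m)
  exact ⟨b, hb, mults_mem_of_dvd hbc (hm n)⟩

/-! ### The kernel of `σ_w` -/

variable (hM : IsNonstandardModel M) {w : Ultrafilter ℤ} (hw : w ≠ pure 0)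

theorem toZHat_mem_ker_iff (u : Ultrafilter ℤ) :
    toZHat u ∈ (sigma hM w hw).ker ↔ ∀ᶠ d in (w : Filter ℤ), mults d ∈ u := by
  have h0 : toZHat (pure 0) = 0 := Subtype.ext (funext fun n => by
    change residue (pure 0) n = 0
    rw [residue_pure, Int.cast_zero])
  have h1 : rho hM w hw (pure 0) = 0 := by rw [← sigma_toZHat, h0, map_zero]
  rw [AddMonoidHom.mem_ker, sigma_toZHat, ← h1, rho_eq_iff, hM.sEquiv_zero_iff]
  rfl

/-- For every `n` some `u` congruent to `w` modulo `n` is divisible by `w`-almost all integers.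
With `g = gcd(w, n)`, for `w`-almost all `d` one has `gcd(d, n) = g`, and then `d / g` is coprime to
`n / g`; so the conditions `u ≡ w` modulo `n` and `u ≡ 0` modulo any finitely many such `d` are
jointly satisfiable. -/
theorem exists_residue_eq_and_eventually_mults_mem (w : Ultrafilter ℤ) (n : ℕ+) :
    ∃ u : Ultrafilter ℤ, residue u n = residue w n ∧ ∀ᶠ d in (w : Filter ℤ), mults d ∈ u := by
  classical
  obtain ⟨r, hr⟩ := exists_representative w n.ne_zero
  set g : ℕ := Int.gcd r ((n : ℕ) : ℤ) with hg
  have hg0 : 0 < g := Int.gcd_pos_of_ne_zero_right _ (by exact_mod_cast n.ne_zero)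
  obtain ⟨r', hr'⟩ : (g : ℤ) ∣ r := Int.gcd_dvd_left _ _
  obtain ⟨n', hn'⟩ : (g : ℤ) ∣ ((n : ℕ) : ℤ) := Int.gcd_dvd_right _ _
  have hS : ∀ᶠ d in (w : Filter ℤ), (g : ℤ) ∣ d ∧ IsCoprime (d / g) n' := by
    filter_upwards [hr] with d hd
    have hgd : Int.gcd d ((n : ℕ) : ℤ) = g := by
      refine Nat.dvd_antisymm ?_ ?_ <;> refine Int.natCast_dvd_natCast.1 (Int.dvd_coe_gcd ?_ ?_)
      · exact (dvd_iff_dvd_of_dvd_sub ((Int.gcd_dvd_right _ _).trans hd)).1 (Int.gcd_dvd_left _ _)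
      · exact Int.gcd_dvd_right _ _
      · exact (dvd_iff_dvd_of_dvd_sub ((Int.gcd_dvd_right _ _).trans hd)).2 (Int.gcd_dvd_left _ _)
      · exact Int.gcd_dvd_right _ _
    refine ⟨hgd ▸ Int.gcd_dvd_left _ _, Int.isCoprime_iff_gcd_eq_one.2 ?_⟩
    have h1 := Int.gcd_div_gcd_div_gcd (i := d) (j := ((n : ℕ) : ℤ)) (by rw [hgd]; exact hg0)
    rwa [hgd, hn', Int.mul_ediv_cancel_left n' (by exact_mod_cast hg0.ne')] at h1
  have hx : ∀ k : ℕ, ∃ x : ℤ, ((n : ℕ) : ℤ) ∣ x - r ∧ ∀ d ∈ Finset.Icc (-(k : ℤ)) k,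
      ((g : ℤ) ∣ d ∧ IsCoprime (d / g) n') → d ∣ x := by
    intro k
    set T := (Finset.Icc (-(k : ℤ)) k).filter fun d => (g : ℤ) ∣ d ∧ IsCoprime (d / g) n' with hT
    have hcop : IsCoprime (∏ d ∈ T, d / (g : ℤ)) n' :=
      IsCoprime.prod_left fun d hd => (Finset.mem_filter.1 hd).2.2
    obtain ⟨a, b, hab⟩ := hcop
    refine ⟨g * ((∏ d ∈ T, d / (g : ℤ)) * (a * r')), ?_, fun d hd hd' => ?_⟩
    · rw [hn', hr', ← mul_sub]
      refine mul_dvd_mul_left _ ⟨-b * r', ?_⟩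
      linear_combination r' * hab
    · calc d = g * (d / g) := (Int.mul_ediv_cancel' hd'.1).symm
        _ ∣ _ := mul_dvd_mul_left _ (Dvd.dvd.mul_right
          (Finset.dvd_prod_of_mem (fun d : ℤ => d / (g : ℤ)) (Finset.mem_filter.2 ⟨hd, hd'⟩)) _)
  choose x hx1 hx2 using hx
  refine ⟨(hyperfilter ℕ).map x, ?_, ?_⟩
  · have h1 : ∀ᶠ k in (hyperfilter ℕ : Filter ℕ), ((x k : ℤ) : ZMod (n : ℕ)) = residue w n := by
      refine Eventually.of_forall fun k => ?_
      obtain ⟨a, ha1, ha2⟩ := ((residue_spec w n).and hr).exists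
      rw [← ha1, ← (ZMod.intCast_eq_intCast_iff_dvd_sub r a n).2 ha2]
      exact ((ZMod.intCast_eq_intCast_iff_dvd_sub r (x k) n).2 (hx1 k)).symm
    exact residue_eq h1
  · filter_upwards [hS] with d hd
    have h1 : ∀ᶠ k in (hyperfilter ℕ : Filter ℕ), d ∣ x k := by
      filter_upwards [Nat.hyperfilter_le_atTop (eventually_ge_atTop d.natAbs)] with k hk
      exact hx2 k d (Finset.mem_Icc.2 (by omega)) hd
    exact h1

/-- The sets of points of `ℤ^` with a given remainder class modulo one `n` form a basis of the
topology, as finitely many moduli can be replaced by their product. -/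
theorem mem_closure_of_forall_exists {K : Set ZHat} {x : ZHat}
    (h : ∀ n : ℕ+, ∃ y ∈ K, y.1 n = x.1 n) : x ∈ closure K := by
  have hdiv : ∀ {m n : ℕ+} {y : ZHat}, (m : ℕ) ∣ n → y.1 n = x.1 n → y.1 m = x.1 m := by
    intro m n y hmn hy
    rw [← y.2 m n hmn, ← x.2 m n hmn, hy]
  rw [mem_closure_iff_nhds]
  intro U hU
  rw [nhds_subtype, mem_comap] at hU
  obtain ⟨V, hV, hVU⟩ := hU
  rw [nhds_pi, Filter.mem_pi] at hV
  obtain ⟨I, hI, t, ht, htV⟩ := hV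
  obtain ⟨y, hyK, hy⟩ := h (∏ n ∈ hI.toFinset, n)
  refine ⟨y, hVU (htV fun n hn => ?_), hyK⟩
  have hn' : (n : ℕ) ∣ ((∏ n ∈ hI.toFinset, n : ℕ+) : ℕ) :=
    PNat.dvd_iff.1 (Finset.dvd_prod_of_mem _ (hI.mem_toFinset.2 hn))
  rw [hdiv hn' hy]
  exact mem_of_mem_nhds (ht n)

theorem D_mem_of_isClosed_ker (h : IsClosed ((sigma hM w hw).ker : Set ZHat)) : D w ∈ w := by
  have hcl : toZHat w ∈ closure ((sigma hM w hw).ker : Set ZHat) := by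
    refine mem_closure_of_forall_exists fun n => ?_
    obtain ⟨u, hu, hu'⟩ := exists_residue_eq_and_eventually_mults_mem w n
    exact ⟨toZHat u, (toZHat_mem_ker_iff hM hw u).2 hu', hu⟩
  rw [h.closure_eq] at hcl
  exact (toZHat_mem_ker_iff hM hw w).1 hcl

/-! ### Profinite quotients -/

/-- Points of `ℤ^` which vanish modulo `n` are multiples of `n`. -/
theorem exists_nsmul_eq {x : ZHat} {n : ℕ+} (hx : x.1 n = 0) : ∃ y : ZHat, (n : ℕ) • y = x := by
  obtain ⟨u, rfl⟩ := toZHat_surjective x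
  refine ⟨toZHat (u.map fun a => a / ((n : ℕ) : ℤ)), Subtype.ext (funext fun m => ?_)⟩
  have h1 : ∀ᶠ a in (u : Filter ℤ), ((a / ((n : ℕ) : ℤ) : ℤ) : ZMod (m : ℕ)) =
      residue (u.map fun a => a / ((n : ℕ) : ℤ)) m := residue_spec (u.map _) m
  have h2 : ∀ᶠ a in (u : Filter ℤ), ((n : ℕ) : ℤ) ∣ a := (mults_mem_iff_residue u n).2 hx
  obtain ⟨a, ⟨h1, h2⟩, h3⟩ := ((h1.and h2).and (residue_spec u m)).exists
  change (n : ℕ) • residue (u.map fun a => a / ((n : ℕ) : ℤ)) m = residue u m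
  rw [← h1, ← h3, nsmul_eq_mul, ← Int.cast_natCast, ← Int.cast_mul, Int.mul_ediv_cancel' h2]

/-- A subgroup of finite index of `ℤ^` contains some `n ℤ^`, which is open. -/
theorem isClosed_of_finiteIndex (H : AddSubgroup ZHat) [H.FiniteIndex] :
    IsClosed (H : Set ZHat) := by
  obtain ⟨n, hn⟩ : ∃ n : ℕ+, (n : ℕ) = H.index :=
    ⟨⟨H.index, Nat.pos_of_ne_zero AddSubgroup.FiniteIndex.index_ne_zero⟩, rfl⟩
  rw [← closure_subset_iff_isClosed]
  intro x hx
  have hcont : Continuous fun y : ZHat => y.1 n :=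
    (continuous_apply n).comp continuous_subtype_val
  obtain ⟨y, hy, hyH⟩ := mem_closure_iff.1 hx _ ((isOpen_discrete {x.1 n}).preimage hcont) rfl
  have hsub : (x - y).1 n = 0 := sub_eq_zero.2 (Eq.symm hy)
  obtain ⟨z, hz⟩ := exists_nsmul_eq hsub
  have hz' : x - y ∈ H := by
    rw [← hz, hn]
    exact H.nsmul_index_mem z
  simpa using H.add_mem hz' hyH

/-- Every homomorphism from `ℤ^` to a profinite group has a closed kernel, because the open
subgroups of the target, which have finite index, intersect in `0`. -/
theorem isClosed_ker_of_isProfiniteGroup {A : Type*} [AddCommGroup A] {t : TopologicalSpace A}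
    (ht : IsProfiniteGroup t) (f : ZHat →+ A) : IsClosed (f.ker : Set ZHat) := by
  obtain ⟨h1, h2, h3, h4⟩ := ht
  have hker : (f.ker : Set ZHat) =
      ⋂ U : OpenAddSubgroup A, ((U : AddSubgroup A).comap f : Set ZHat) := by
    ext x
    simp only [SetLike.mem_coe, Set.mem_iInter]
    constructor
    · intro hx U
      change f x ∈ (U : AddSubgroup A)
      rw [AddMonoidHom.mem_ker.1 hx]
      exact zero_mem _
    · intro hx
      by_contra hfx
      obtain ⟨W, hW, h0, hxW⟩ := exists_isClopen_of_totally_separated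
        (show (0 : A) ≠ f x from fun h => hfx h.symm)
      obtain ⟨U, hU⟩ := IsTopologicalAddGroup.exist_openAddSubgroup_sub_clopen_nhds_of_zero hW h0
      exact hxW (hU (hx U))
  rw [hker]
  refine isClosed_iInter fun U => ?_
  have : (U : AddSubgroup A).FiniteIndex := AddSubgroup.finiteIndex_of_finite_quotient
  have : ((U : AddSubgroup A).comap f).FiniteIndex := ⟨by
    rw [AddSubgroup.index_comap]
    exact (inferInstance : ((U : AddSubgroup A).addSubgroupOf f.range).FiniteIndex).index_ne_zero⟩
  exact isClosed_of_finiteIndex _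

end model

section profinite

theorem isProfiniteGroup_induced {A B : Type*} [AddCommGroup A] [AddCommGroup B]
    {t : TopologicalSpace B} (ht : IsProfiniteGroup t) (e : A ≃+ B) :
    IsProfiniteGroup (t.induced e) := by
  obtain ⟨h1, h2, h3, h4⟩ := ht
  let _ : TopologicalSpace A := t.induced e
  let h : A ≃ₜ B := e.toEquiv.toHomeomorphOfIsInducing ⟨rfl⟩
  exact ⟨topologicalAddGroup_induced e, h.symm.compactSpace, h.symm.t2Space,
    h.symm.totallyDisconnectedSpace⟩

theorem exists_isProfiniteGroup_pi {ι : Type*} {A : ι → Type*} [∀ i, AddCommGroup (A i)]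
    (h : ∀ i, ∃ t : TopologicalSpace (A i), IsProfiniteGroup t) :
    ∃ t : TopologicalSpace (∀ i, A i), IsProfiniteGroup t := by
  choose t ht using h
  have h1 := fun i => (ht i).1
  have h2 := fun i => (ht i).2.1
  have h3 := fun i => (ht i).2.2.1
  have h4 := fun i => (ht i).2.2.2
  exact ⟨Pi.topologicalSpace, inferInstance, inferInstance, inferInstance, inferInstance⟩

theorem exists_isProfiniteGroup_G (p : Nat.Primes) (α : WithTop ℕ) :
    ∃ t : TopologicalSpace (G p α), IsProfiniteGroup t := by
  have : Fact (p : ℕ).Prime := ⟨p.2⟩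
  cases α with
  | top =>
    exact ⟨inferInstanceAs (TopologicalSpace ℤ_[(p : ℕ)]),
      inferInstanceAs (IsTopologicalAddGroup ℤ_[(p : ℕ)]),
      inferInstanceAs (CompactSpace ℤ_[(p : ℕ)]), inferInstanceAs (T2Space ℤ_[(p : ℕ)]),
      inferInstanceAs (TotallyDisconnectedSpace ℤ_[(p : ℕ)])⟩
  | coe k =>
    exact ⟨inferInstanceAs (TopologicalSpace (ZMod ((p : ℕ) ^ k))),
      inferInstanceAs (IsTopologicalAddGroup (ZMod ((p : ℕ) ^ k))),
      inferInstanceAs (CompactSpace (ZMod ((p : ℕ) ^ k))),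
      inferInstanceAs (T2Space (ZMod ((p : ℕ) ^ k))),
      inferInstanceAs (TotallyDisconnectedSpace (ZMod ((p : ℕ) ^ k)))⟩

end profinite

section quotient

variable {M : Type*} [fullLang.Structure M]

/-- An additive map on `βℤ` whose fibres are the classes of `≡ˢ_w` induces an injective
homomorphism on the quotient. -/
theorem exists_injective_addMonoidHom (hM : IsNonstandardModel M) {w : Ultrafilter ℤ}
    (hw : w ≠ pure 0) {A : Type*} [AddCommGroup A] (θ : Ultrafilter ℤ → A)
    (hadd : ∀ u v, θ (u + v) = θ u + θ v) (hθ : ∀ u v, θ u = θ v ↔ SEquiv M w u v) :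
    ∃ f : BetaQuot hM w hw →+ A, Function.Injective f ∧ ∀ u, f (rho hM w hw u) = θ u := by
  have hs := rho_surjective hM w hw
  have hf : ∀ u, θ (Function.surjInv hs (rho hM w hw u)) = θ u := fun u =>
    (hθ _ _).2 ((rho_eq_iff hM w hw _ _).1 (Function.surjInv_eq hs _))
  refine ⟨AddMonoidHom.mk' (fun q => θ (Function.surjInv hs q)) fun q q' => ?_, fun q q' h => ?_, hf⟩
  · obtain ⟨u, rfl⟩ := hs q
    obtain ⟨v, rfl⟩ := hs q'
    rw [← rho_add, hf, hf, hf, hadd]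
  · obtain ⟨u, rfl⟩ := hs q
    obtain ⟨v, rfl⟩ := hs q'
    have h' : θ u = θ v := (hf u).symm.trans (h.trans (hf v))
    exact (rho_eq_iff hM w hw u v).2 ((hθ u v).1 h')

theorem continuous_residue (n : ℕ+) : Continuous fun u : Ultrafilter ℤ => residue u n := by
  rw [continuous_discrete_rng]
  intro r
  convert! ultrafilter_isOpen_basic {a : ℤ | (a : ZMod (n : ℕ)) = r} using 1
  ext u
  exact ⟨fun h => h ▸ residue_spec u n, fun h => residue_eq h⟩

/-- If `w` is self-divisible, its quotient embeds into the product of the `ℤ / nℤ` over the `n`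
dividing `w`, as a compact subgroup; the class of `1` generates a dense subgroup. -/
theorem SelfDivisible.isProcyclicGroup (hM : IsNonstandardModel M) {w : Ultrafilter ℤ}
    (h : SelfDivisible w) (hw : w ≠ pure 0) : IsProcyclicGroup (quotientTopology hM w hw) := by
  obtain ⟨f, hf, hfrho⟩ := exists_injective_addMonoidHom hM hw
    (A := ∀ n : {n : ℕ+ // mults ((n : ℕ) : ℤ) ∈ w}, ZMod (n.1 : ℕ))
    (fun u n => residue u n.1) (fun u v => funext fun n => residue_add u v n.1)
    (fun u v => by
      rw [hM.sEquiv_iff_of_selfDivisible h, funext_iff, Subtype.forall])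
  let _ := quotientTopology hM w hw
  have hrho : Continuous (rho hM w hw) := continuous_coinduced_rng
  have hcont : Continuous f := by
    refine continuous_coinduced_dom.2 ?_
    rw [show f ∘ rho hM w hw =
      fun u (n : {n : ℕ+ // mults ((n : ℕ) : ℤ) ∈ w}) => residue u n.1 from funext fun u => hfrho u]
    exact continuous_pi fun n => continuous_residue n.1
  have hcomp : CompactSpace (BetaQuot hM w hw) := (rho_surjective hM w hw).compactSpace hrho
  have hemb := hcont.isClosedEmbedding hf
  refine ⟨⟨hemb.isInducing.topologicalAddGroup f, hcomp, hemb.isEmbedding.t2Space,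
    ⟨hemb.isEmbedding.isTotallyDisconnected (isTotallyDisconnected_of_totallyDisconnectedSpace _)⟩⟩,
    rho hM w hw (pure 1), ?_⟩
  refine ((rho_surjective hM w hw).denseRange.comp denseRange_pure hrho).mono ?_
  rintro _ ⟨n, rfl⟩
  refine AddSubgroup.mem_zmultiples_iff.2 ⟨n, hf ?_⟩
  rw [map_zsmul, hfrho, Function.comp_apply, hfrho]
  funext m
  rw [Pi.smul_apply, residue_pure, residue_pure, zsmul_eq_mul, Int.cast_one, mul_one]

/-! ### The decomposition into `p`-primary parts -/

theorem coe_le_phi_iff (w : Ultrafilter ℤ) (p : Nat.Primes) (k : ℕ) :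
    (k : WithTop ℕ) ≤ phi w p ↔ mults (((p : ℕ) : ℤ) ^ k) ∈ w := by
  have hmono : ∀ {i j : ℕ}, i ≤ j → mults (((p : ℕ) : ℤ) ^ j) ∈ w →
      mults (((p : ℕ) : ℤ) ^ i) ∈ w := fun h => mults_mem_of_dvd (pow_dvd_pow _ h)
  rw [phi]
  split_ifs with h
  · exact ⟨fun hk => hmono (WithTop.coe_le_coe.1 hk) h.choose_spec.1,
      fun hk => WithTop.coe_le_coe.2 (h.choose_spec.2 hk)⟩
  · simp only [le_top, true_iff]
    by_contra hk
    have hbdd : BddAbove {k : ℕ | mults (((p : ℕ) : ℤ) ^ k) ∈ w} := by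
      refine ⟨k, fun i hi => ?_⟩
      by_contra hik
      exact hk (hmono (not_le.1 hik).le hi)
    refine h ⟨_, Nat.sSup_mem ⟨0, ?_⟩ hbdd, fun i hi => le_csSup hbdd hi⟩
    exact Eventually.of_forall fun a => by
      rw [pow_zero]
      exact one_dvd a

/-- The projections of `G p α` to the `ℤ / p ^ j ℤ` with `j ≤ α`: they are compatible, separate
points, and the remainder classes of every ultrafilter are the projections of some point (for
`ℤ_p`, of its limit). -/
theorem exists_projections (p : Nat.Primes) (α : WithTop ℕ) :
    ∃ q : ∀ j : ℕ, (j : WithTop ℕ) ≤ α → G p α →+ ZMod ((p : ℕ) ^ j),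
      (∀ x y, (∀ j hj, q j hj x = q j hj y) → x = y) ∧
      (∀ (i j : ℕ) (hij : i ≤ j) (hi : (i : WithTop ℕ) ≤ α) (hj : (j : WithTop ℕ) ≤ α) (x),
        ZMod.castHom (pow_dvd_pow (p : ℕ) hij) (ZMod ((p : ℕ) ^ i)) (q j hj x) = q i hi x) ∧
      ∀ u : Ultrafilter ℤ, ∃ x, ∀ j hj,
        ∀ᶠ a : ℤ in (u : Filter ℤ), (a : ZMod ((p : ℕ) ^ j)) = q j hj x := by
  have : Fact (p : ℕ).Prime := ⟨p.2⟩
  cases α with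
  | top =>
    refine ⟨fun j _ => (PadicInt.toZModPow j : ℤ_[(p : ℕ)] →+* ZMod ((p : ℕ) ^ j)).toAddMonoidHom,
      fun x y h => PadicInt.ext_of_toZModPow.1 fun n => h n le_top,
      fun i j hij _ _ x => DFunLike.congr_fun (PadicInt.zmod_cast_comp_toZModPow i j hij) x,
      fun u => ?_⟩
    obtain ⟨x, -, hx⟩ := isCompact_univ.ultrafilter_le_nhds
      (u.map fun a : ℤ => (a : ℤ_[(p : ℕ)])) (by simp)
    refine ⟨x, fun j _ => ?_⟩
    have hpos : (0 : ℝ) < ((p : ℕ) : ℝ) ^ (-j : ℤ) :=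
      zpow_pos (by exact_mod_cast p.2.pos) _
    have h1 : ∀ᶠ a : ℤ in (u : Filter ℤ), (a : ℤ_[(p : ℕ)]) ∈ Metric.closedBall x _ :=
      hx (Metric.closedBall_mem_nhds x hpos)
    filter_upwards [h1] with a ha
    rw [Metric.mem_closedBall, dist_eq_norm, PadicInt.norm_le_pow_iff_mem_span_pow,
      ← PadicInt.ker_toZModPow, RingHom.mem_ker, map_sub, sub_eq_zero, map_intCast] at ha
    exact ha
  | coe k =>
    have hle : ∀ j : ℕ, (j : WithTop ℕ) ≤ (k : WithTop ℕ) → j ≤ k :=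
      fun j hj => WithTop.coe_le_coe.1 hj
    refine ⟨fun j hj => (ZMod.castHom (pow_dvd_pow (p : ℕ) (hle j hj))
      (ZMod ((p : ℕ) ^ j))).toAddMonoidHom, fun x y h => ?_, fun i j hij hi hj x => ?_, fun u => ?_⟩
    · have hid : ∀ z : ZMod ((p : ℕ) ^ k),
          ZMod.castHom (pow_dvd_pow (p : ℕ) (hle k le_rfl)) (ZMod ((p : ℕ) ^ k)) z = z :=
        fun z => by rw [ZMod.castHom_self, RingHom.id_apply]
      exact (hid x).symm.trans ((h k le_rfl).trans (hid y))
    · exact DFunLike.congr_fun (RingHom.ext_zmod ((ZMod.castHom (pow_dvd_pow (p : ℕ) hij)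
        (ZMod ((p : ℕ) ^ i))).comp (ZMod.castHom (pow_dvd_pow (p : ℕ) (hle j hj))
        (ZMod ((p : ℕ) ^ j)))) (ZMod.castHom (pow_dvd_pow (p : ℕ) (hle i hi)) _)) x
    · obtain ⟨r, hr⟩ := exists_residue u ⟨(p : ℕ) ^ k, pow_pos p.2.pos k⟩
      refine ⟨r, fun j hj => ?_⟩
      filter_upwards [(hr : ∀ᶠ a : ℤ in (u : Filter ℤ), (a : ZMod ((p : ℕ) ^ k)) = r)] with a ha
      rw [← ha]
      exact (map_intCast (ZMod.castHom (pow_dvd_pow (p : ℕ) (hle j hj)) (ZMod ((p : ℕ) ^ j))) a).symm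

/-- Compatible remainder classes modulo powers of distinct primes are those of an ultrafilter, by
the Chinese remainder theorem and compactness. -/
theorem exists_ultrafilter_of_prime_pow (α : Nat.Primes → WithTop ℕ)
    (x : ∀ (p : Nat.Primes) (j : ℕ), (j : WithTop ℕ) ≤ α p → ZMod ((p : ℕ) ^ j))
    (hx : ∀ (p : Nat.Primes) (i j : ℕ) (hij : i ≤ j) (hi : (i : WithTop ℕ) ≤ α p)
      (hj : (j : WithTop ℕ) ≤ α p),
      ZMod.castHom (pow_dvd_pow (p : ℕ) hij) (ZMod ((p : ℕ) ^ i)) (x p j hj) = x p i hi) :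
    ∃ u : Ultrafilter ℤ, ∀ (p : Nat.Primes) (j : ℕ) (hj),
      ∀ᶠ a : ℤ in (u : Filter ℤ), (a : ZMod ((p : ℕ) ^ j)) = x p j hj := by
  have hexp : ∀ (N : ℕ) (p : Nat.Primes), ∃ e : ℕ, (e : WithTop ℕ) ≤ α p ∧
      ∀ j ≤ N, (j : WithTop ℕ) ≤ α p → j ≤ e := by
    intro N p
    cases h : α p with
    | top => exact ⟨N, le_top, fun j hj _ => hj⟩
    | coe k => exact ⟨k, le_rfl, fun j _ hj => WithTop.coe_le_coe.1 hj⟩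
  have hcrt : ∀ N : ℕ, ∃ a : ℤ, ∀ p : Nat.Primes, (p : ℕ) ≤ N → ∀ j ≤ N, ∀ hj,
      (a : ZMod ((p : ℕ) ^ j)) = x p j hj := by
    intro N
    choose e he1 he2 using hexp N
    have hfin : {p : Nat.Primes | (p : ℕ) ≤ N}.Finite :=
      (Set.finite_Iic N).preimage Nat.Primes.coe_nat_injective.injOn
    have hr : ∀ p : Nat.Primes, ∃ r : ℕ, (r : ZMod ((p : ℕ) ^ e p)) = x p (e p) (he1 p) := by
      intro p
      have : NeZero ((p : ℕ) ^ e p) := ⟨(pow_pos p.2.pos _).ne'⟩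
      exact ZMod.natCast_zmod_surjective _
    choose r hr using hr
    obtain ⟨a, ha⟩ := Nat.chineseRemainderOfFinset r (fun p : Nat.Primes => (p : ℕ) ^ e p)
      hfin.toFinset (fun p _ => (pow_pos p.2.pos _).ne') (fun p _ p' _ hpp' =>
        Nat.Coprime.pow _ _ ((Nat.coprime_primes p.2 p'.2).2 fun h =>
          hpp' (Nat.Primes.coe_nat_injective h)))
    refine ⟨a, fun p hp j hj hj' => ?_⟩
    have h1 : (a : ZMod ((p : ℕ) ^ e p)) = x p (e p) (he1 p) := by
      rw [← hr p]
      exact (ZMod.natCast_eq_natCast_iff _ _ _).2 (ha p (hfin.mem_toFinset.2 hp))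
    rw [← hx p j (e p) (he2 p j hj hj') hj' (he1 p), ← h1, map_natCast, Int.cast_natCast]
  choose a ha using hcrt
  refine ⟨(hyperfilter ℕ).map a, fun p j hj => ?_⟩
  have h1 : ∀ᶠ N in (hyperfilter ℕ : Filter ℕ), ((a N : ℤ) : ZMod ((p : ℕ) ^ j)) = x p j hj := by
    filter_upwards [Nat.hyperfilter_le_atTop (eventually_ge_atTop (p : ℕ)),
      Nat.hyperfilter_le_atTop (eventually_ge_atTop j)] with N hN hN'
    exact ha N p hN j hN' hj
  exact h1

theorem residue_eq_residue_iff_prime_pow (u v : Ultrafilter ℤ) (n : ℕ+) :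
    residue u n = residue v n ↔ ∀ (p : Nat.Primes) (k : ℕ), (p : ℕ) ^ k ∣ n →
      mults (((p : ℕ) : ℤ) ^ k) ∈ u + v.map (fun a => -a) := by
  rw [residue_eq_residue_iff, mults_mem_iff_prime_pow _ n.ne_zero]
  exact ⟨fun h p k => h p k p.2, fun h p k hp => h ⟨p, hp⟩ k⟩

theorem mults_mem_add_map_neg_iff {u v : Ultrafilter ℤ} {n : ℕ} {r s : ZMod n}
    (hr : ∀ᶠ a : ℤ in (u : Filter ℤ), (a : ZMod n) = r)
    (hs : ∀ᶠ a : ℤ in (v : Filter ℤ), (a : ZMod n) = s) :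
    mults (n : ℤ) ∈ u + v.map (fun a => -a) ↔ r = s := by
  have h : ∀ᶠ a : ℤ in ((u + v.map (fun a => -a) : Ultrafilter ℤ) : Filter ℤ),
      (a : ZMod n) = r - s := by
    rw [Ultrafilter.eventually_add]
    filter_upwards [hr] with a ha
    change ∀ᶠ b : ℤ in (v : Filter ℤ), ((a + -b : ℤ) : ZMod n) = r - s
    filter_upwards [hs] with b hb
    rw [← ha, ← hb, Int.cast_add, Int.cast_neg, sub_eq_add_neg]
  rw [← sub_eq_zero (a := r)]
  have h' : ∀ᶠ a : ℤ in ((u + v.map (fun a => -a) : Ultrafilter ℤ) : Filter ℤ),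
      ((n : ℤ) ∣ a ↔ r - s = 0) := by
    filter_upwards [h] with a ha
    rw [← ha]
    exact (ZMod.intCast_zmod_eq_zero_iff_dvd a n).symm
  exact (eventually_congr h').trans eventually_const

theorem SelfDivisible.nonempty_addEquiv (hM : IsNonstandardModel M) {w : Ultrafilter ℤ}
    (h : SelfDivisible w) (hw : w ≠ pure 0) :
    Nonempty (BetaQuot hM w hw ≃+ ∀ p : Nat.Primes, G p (phi w p)) := by
  choose q hinj hcomp hex using fun p => exists_projections p (phi w p)
  choose θ hθ using fun (u : Ultrafilter ℤ) p => hex p u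
  have huniq : ∀ (u : Ultrafilter ℤ) (x : ∀ p : Nat.Primes, G p (phi w p)),
      (∀ (p : Nat.Primes) (j : ℕ) (hj), ∀ᶠ a : ℤ in (u : Filter ℤ), (a : ZMod ((p : ℕ) ^ j)) = q p j hj (x p)) →
      θ u = x := by
    intro u x hx
    refine funext fun p => hinj p _ _ fun j hj => ?_
    obtain ⟨a, ha, ha'⟩ := ((hθ u p j hj).and (hx p j hj)).exists
    rw [← ha, ha']
  have hadd : ∀ u v, θ (u + v) = θ u + θ v := by
    refine fun u v => huniq _ _ fun p j hj => ?_
    rw [Ultrafilter.eventually_add]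
    filter_upwards [hθ u p j hj] with a ha
    filter_upwards [hθ v p j hj] with b hb
    rw [Int.cast_add, ha, hb, Pi.add_apply, map_add]
  have hiff : ∀ u v, θ u = θ v ↔ SEquiv M w u v := by
    intro u v
    rw [hM.sEquiv_iff_of_selfDivisible h]
    have hkey : ∀ (p : Nat.Primes) (j : ℕ) (hj), mults (((p : ℕ) : ℤ) ^ j) ∈ u + v.map (fun a => -a) ↔
        q p j hj (θ u p) = q p j hj (θ v p) := by
      intro p j hj
      rw [← Nat.cast_pow]
      exact mults_mem_add_map_neg_iff (hθ u p j hj) (hθ v p j hj)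
    constructor
    · intro huv n hn
      rw [residue_eq_residue_iff_prime_pow]
      intro p k hk
      have hk' : (k : WithTop ℕ) ≤ phi w p :=
        (coe_le_phi_iff w p k).2 (mults_mem_of_dvd (by exact_mod_cast hk) hn)
      rw [hkey p k hk', huv]
    · intro huv
      refine funext fun p => hinj p _ _ fun j hj => (hkey p j hj).1 ?_
      have hn := (residue_eq_residue_iff u v ⟨(p : ℕ) ^ j, pow_pos p.2.pos j⟩).1 (huv _ (by
        have := (coe_le_phi_iff w p j).1 hj
        rw [← Nat.cast_pow] at this
        exact this))
      rw [← Nat.cast_pow]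
      exact hn
  obtain ⟨f, hf, hfrho⟩ := exists_injective_addMonoidHom hM hw θ hadd hiff
  refine ⟨AddEquiv.ofBijective f ⟨hf, fun x => ?_⟩⟩
  obtain ⟨u, hu⟩ := exists_ultrafilter_of_prime_pow (phi w) (fun p j hj => q p j hj (x p))
    (fun p i j hij hi hj => hcomp p i j hij hi hj (x p))
  exact ⟨rho hM w hw u, (hfrho u).trans (huniq u x hu)⟩

end quotient

end SelfDiv

theorem theorem7p6 {M : Type*} [fullLang.Structure M] (hM : IsNonstandardModel M)
    (w : Ultrafilter ℤ) (hw : w ≠ pure 0) :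
    List.TFAE [
      SelfDivisible w,
      ∀ B ∈ w, ∃ A ∈ w, ∀ a ∈ A, ∀ a' ∈ A, ∃ b ∈ B, b ∣ (Int.gcd a a' : ℤ),
      ∀ B ∈ w, ∃ A ∈ w, ∃ b ∈ B, A ⊆ mults b,
      ∀ B ∈ w, ∃ b ∈ B, mults b ∈ w,
      ∀ B ∈ w, {b ∈ B | mults b ∈ w} ∈ w,
      ∀ k : ℤ, k ≠ 0 → SelfDivisible (smulInt k w),
      ∃ n m : ℕ, 0 < n ∧ 0 < m ∧ n ≠ m ∧ SEquiv M w (oplusPow w n) (oplusPow w m),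
      ∀ v : Ultrafilter ℤ, v ≠ pure 0 → WEquiv M v w (pure 0) → SEquiv M v w (pure 0),
      ∀ a : M, Realizes a w → {b : M | StarDvd b a} ⊆ star₁ M (D w),
      (∀ u ∈ Z M w, ∀ v ∈ Z M w, u + v ∈ Z M w) ∧
        ∀ v ∈ MAX M, ∀ u t : Ultrafilter ℤ, u + v + t ∈ Z M w → u + t ∈ Z M w,
      (∀ u ∈ Z M w, ∀ v ∈ Z M w, u + v ∈ Z M w) ∧
        Z M w = toZHat ⁻¹' (toZHat '' Z M w),
      (∀ u ∈ Z M w, ∀ v ∈ Z M w, u + v ∈ Z M w) ∧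
        ∀ u u' : Ultrafilter ℤ, (∀ n : ℕ+, residue u n = residue u' n) →
          (WDvd M w u ↔ WDvd M w u'),
      IsClosed ((sigma hM w hw).ker : Set ZHat),
      IsProcyclicGroup (quotientTopology hM w hw),
      ∃ t : TopologicalSpace (BetaQuot hM w hw), IsProfiniteGroup t,
      Nonempty (BetaQuot hM w hw ≃+ ∀ p : Nat.Primes, G p (phi w p))] := by
  have hdiv : SelfDivisible w ↔ ∀ B ∈ w, ∃ b ∈ B, mults b ∈ w := by
    refine ⟨fun h B hB => ?_, fun h => ⟨hw, D_mem_of_forall_exists_mults h⟩⟩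
    obtain ⟨b, hb, hb'⟩ := (Filter.Eventually.and (hB : B ∈ (w : Filter ℤ)) h.2).exists
    exact ⟨b, hb, hb'⟩
  tfae_have 1 ↔ 4 := hdiv
  tfae_have 1 → 5 := fun h B hB => Filter.inter_mem hB h.2
  tfae_have 5 → 4 := fun h B hB =>
    have ⟨b, hb⟩ := Ultrafilter.nonempty_of_mem (h B hB)
    ⟨b, hb.1, hb.2⟩
  tfae_have 4 → 3 := fun h B hB =>
    have ⟨b, hb, hb'⟩ := h B hB
    ⟨mults b, hb', b, hb, subset_rfl⟩
  tfae_have 3 → 2 := fun h B hB =>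
    have ⟨A, hA, b, hb, hAb⟩ := h B hB
    ⟨A, hA, fun a ha a' ha' => ⟨b, hb, Int.dvd_coe_gcd (hAb ha) (hAb ha')⟩⟩
  tfae_have 2 → 4 := fun h B hB =>
    have ⟨_, hA, hAB⟩ := h B hB
    exists_mults_of_gcd hw hA hAB
  tfae_have 1 → 6 := fun h k hk => selfDivisible_smulInt h hk
  tfae_have 6 → 1 := fun h => smulInt_one w ▸ h 1 one_ne_zero
  tfae_have 1 → 7 := fun h =>
    ⟨1, 2, one_pos, two_pos, by norm_num, h.sEquiv_oplusPow hM⟩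
  tfae_have 7 → 1 := by
    rintro ⟨n, m, -, -, hnm, h⟩
    refine ⟨hw, ?_⟩
    rcases hnm.lt_or_gt with hlt | hlt
    · obtain ⟨k, rfl⟩ := Nat.exists_eq_add_of_lt hlt
      exact hM.D_mem_of_sEquiv_oplusPow hw k.succ_ne_zero h
    · obtain ⟨k, rfl⟩ := Nat.exists_eq_add_of_lt hlt
      exact hM.D_mem_of_sEquiv_oplusPow hw k.succ_ne_zero ((sCon hM w hw).symm h)
  tfae_have 1 → 8 := fun h v _ hv => (hM.sEquiv_zero_iff w v).2 (hM.D_mem_of_wEquiv h.2 hv)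
  tfae_have 8 → 1 := fun h => ⟨hw, (hM.sEquiv_zero_iff w w).1 (h w hw (hM.wEquiv_self_zero w))⟩
  tfae_have 1 → 9 := by
    obtain ⟨j⟩ := hM.elementary
    exact fun h a ha b hb => mem_star₁_D_of_starDvd j ((ha _).1 h.2) hb
  tfae_have 9 → 1 := by
    obtain ⟨j⟩ := hM.elementary
    obtain ⟨a, ha⟩ := hM.exists_realizes w
    exact fun h => ⟨hw, (ha _).2 (h a ha (starDvd_refl j a))⟩
  tfae_have 1 → 12 := fun h => ⟨fun _ hu _ hv => h.add_mem_Z hM hu hv, fun u u' huu' => by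
    simp only [hM.wDvd_iff_of_selfDivisible h, huu']⟩
  tfae_have 12 → 4 := fun h _ hB => hM.exists_mults_mem h.1 h.2 hB
  tfae_have 12 → 11 := by
    refine fun h => ⟨h.1, (Set.subset_preimage_image _ _).antisymm ?_⟩
    rintro u ⟨u', hu', huu'⟩
    exact (h.2 u' u fun n => congrFun (congrArg Subtype.val huu') n).1 hu'
  tfae_have 11 → 12 := by
    have key : ∀ u u' : Ultrafilter ℤ, Z M w = toZHat ⁻¹' (toZHat '' Z M w) →
        (∀ n : ℕ+, residue u n = residue u' n) → WDvd M w u → WDvd M w u' := by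
      intro u u' h huu' hu
      change u' ∈ Z M w
      rw [h]
      exact ⟨u, hu, Subtype.ext (funext huu')⟩
    exact fun h => ⟨h.1, fun u u' huu' =>
      ⟨key u u' h.2 huu', key u' u h.2 fun n => (huu' n).symm⟩⟩
  tfae_have 12 → 10 := by
    refine fun h => ⟨h.1, fun v hv u t hut => (h.2 _ _ fun n => ?_).1 hut⟩
    rw [residue_add, residue_add, residue_add, (hM.mem_MAX_iff v).1 hv n, add_zero]
  tfae_have 10 → 12 := fun h => ⟨h.1, fun u u' huu' =>
    ⟨fun hu => hM.mem_Z_of_residue_eq hw h.1 h.2 huu' hu,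
      fun hu => hM.mem_Z_of_residue_eq hw h.1 h.2 (fun n => (huu' n).symm) hu⟩⟩
  tfae_have 1 → 14 := fun h => h.isProcyclicGroup hM hw
  tfae_have 14 → 15 := fun h => ⟨_, h.1⟩
  tfae_have 15 → 13 := fun ⟨_, ht⟩ => isClosed_ker_of_isProfiniteGroup ht _
  tfae_have 13 → 1 := fun h => ⟨hw, D_mem_of_isClosed_ker hM hw h⟩
  tfae_have 1 → 16 := fun h => h.nonempty_addEquiv hM hw
  tfae_have 16 → 15 := fun ⟨e⟩ =>
    have ⟨_, ht⟩ := exists_isProfiniteGroup_pi fun p => exists_isProfiniteGroup_G p (phi w p)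
    ⟨_, isProfiniteGroup_induced ht e⟩
  tfae_finish
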